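/- Let $M$ be a smooth manifold (finite-dimensional, Hausdorff, second countable), $H$ a closed $3$-form on $M$, and equip $T\oplus T^*$ with the pairing $\langle X+\alpha,Y+\beta\rangle=\alpha(Y)+\beta(X)$ and the $H$-twisted Dorfman bracket $$[X+\alpha,Y+\beta]_H=[X,Y]+\mathcal L_X\beta-\imath_Y\mathrm d\alpha+\imath_Y\imath_XH .$$ A generalized almost para-complex structure is a smooth bundle endomorphism $\mathcal K$ of $T\oplus T^*$ with $\mathcal K^2=1$ and $\langle\mathcal K\cdot,\mathcal K\cdot\rangle=-\langle\cdot,\cdot\rangle$; it is integrable if the sections of each of its two eigenbundles are closed under $[\cdot,\cdot]_H$. A generalized (indefinite) metric is a smooth bundle endomorphism $\mathcal G$ of $T\oplus T^*$ with $\mathcal G^2=1$ and $\langle\mathcal G\cdot,\mathcal G\cdot\rangle=\langle\cdot,\cdot\rangle$ whose $\pm1$-eigenbundles $C_\pm$ are mapped isomorphically onto $T$ by the projection $T\oplus T^*\to T$; write $\pi_\pm:C_\pm\to T$ for these isomorphisms. Then there are a unique pseudo-Riemannian metric $\eta$ and a unique $2$-form $b$ with $\pi_\pm^{-1}X=X+(b\pm\eta)X$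 for all $X\in T$, where $\eta X=\eta(X,\cdot)$ and $bX=\imath_Xb$. A generalized almost para-Kähler structure is a commuting pair $(\mathcal G,\mathcal K_+)$ of a generalized metric and a generalized almost para-complex structure; it is also denoted $(\mathcal K_+,\mathcal K_-)$ with $\mathcal K_-=\mathcal G\mathcal K_+$, and it is called integrable (with respect to $[\cdot,\cdot]_H$) if both $\mathcal K_+$ and $\mathcal K_-$ are integrable. Its induced bi-para-Hermitian data are $(K_+,K_-,\eta,b)$, where $\eta,b$ are those of $\mathcal G$ and $$K_+=\pi_+\mathcal K_+\pi_+^{-1},\qquad K_-=\pi_-\mathcal K_+\pi_-^{-1}=-\pi_-\mathcal K_-\pi_-^{-1}.$$ Set $\omega_\pm=\eta K_\pm$, i.e. the $2$-forms $\omega_\pm(X,Y)=\eta(K_\pm X,Y)$. For a $k$-form $\theta$ let $\mathrm d^p_\pm\theta=(\Lambda^{k+1}K_\pm)\,\mathrm d\,(\Lambda^kK_\pm)\theta$, where $(\Lambda^kK\,\theta)(X_1,\dots,X_k)=\theta(KX_1,\dots,KX_k)$; when $K_\pm$ is integrable, $\mathrm d^p_\pm=\partial_\pm^{(1,0)}-\partial_\pm^{(0,1)}$.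 **Theorem.** A generalized almost para-Kähler structure $(\mathcal K_+,\mathcal K_-)$ with induced bi-para-Hermitian data $(K_+,K_-,\eta,b)$ is integrable with respect to $[\cdot,\cdot]_H$ if and only if the following two conditions both hold: 1. $K_+$ and $K_-$ are integrable para-complex structures, that is, their Nijenhuis tensors $N_K(X,Y)=[X,Y]+[KX,KY]-K([KX,Y]+[X,KY])$ vanish; 2. $\mathrm d^p_+\omega_+=-\mathrm d^p_-\omega_-=-(H+\mathrm db)$. -/

import Mathlib

open scoped Manifold ContDiff Bundle

noncomputable section

namespace GenGeom

/-! ### The generalized tangent bundle of a manifold -/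

section Bundles

variable (E : Type*) [NormedAddCommGroup E] [NormedSpace ℝ E]
  {M : Type*} [TopologicalSpace M] [ChartedSpace E M]

/-- The tangent space of `M` (a manifold without boundary, modelled on `E`) at `x`. -/
abbrev Tan (x : M) : Type _ := TangentSpace 𝓘(ℝ, E) x

/-- The cotangent space of `M` at `x`. -/
abbrev Cotan (x : M) : Type _ := Tan E x →L[ℝ] ℝ

/-- The fibre at `x` of the generalized tangent bundle `T ⊕ T*`. -/
abbrev GenTan (x : M) : Type _ := Tan E x × Cotan E x

/-- The model fibre of `T ⊕ T*`. -/
abbrev GenModel : Type _ := E × (E →L[ℝ] ℝ)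

variable (M) in
/-- The generalized tangent bundle `T ⊕ T*`, as a direct sum of vector bundles. -/
abbrev GenBundle : M → Type _ :=
  (fun y : M => Tan E y) ×ᵇ (fun y : M => Cotan E y)

instance finiteDimensionalTan [FiniteDimensional ℝ E] (x : M) : FiniteDimensional ℝ (Tan E x) :=
  inferInstanceAs (FiniteDimensional ℝ E)

instance t2SpaceTan (x : M) : T2Space (Tan E x) :=
  inferInstanceAs (T2Space E)

end Bundles

variable {E : Type*} [NormedAddCommGroup E] [NormedSpace ℝ E]
  {M : Type*} [TopologicalSpace M] [ChartedSpace E M]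

/-- Smooth vector fields. -/
def IsSmoothField [IsManifold 𝓘(ℝ, E) ∞ M] (X : Π x : M, Tan E x) : Prop :=
  ContMDiff 𝓘(ℝ, E) (𝓘(ℝ, E).prod 𝓘(ℝ, E)) ∞
    (fun x => Bundle.TotalSpace.mk' E x (X x))

/-- Smooth sections of `T ⊕ T*`. -/
def IsSmoothSection [IsManifold 𝓘(ℝ, E) ∞ M] (u : Π x : M, GenTan E x) : Prop :=
  ContMDiff 𝓘(ℝ, E) (𝓘(ℝ, E).prod 𝓘(ℝ, GenModel E)) ∞
    (fun x => Bundle.TotalSpace.mk' (GenModel E) (E := GenBundle E M) x (u x))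

/-- Smooth bundle endomorphisms of `T ⊕ T*` (smooth sections of the endomorphism bundle). -/
def IsSmoothEnd [IsManifold 𝓘(ℝ, E) ∞ M] (A : Π x : M, GenTan E x →L[ℝ] GenTan E x) : Prop :=
  ContMDiff 𝓘(ℝ, E) (𝓘(ℝ, E).prod 𝓘(ℝ, GenModel E →L[ℝ] GenModel E)) ∞
    (fun x => Bundle.TotalSpace.mk' (GenModel E →L[ℝ] GenModel E)
      (E := fun y : M => GenBundle E M y →L[ℝ] GenBundle E M y) x (A x))

/-! ### Differential forms and the exterior derivative -/

/-- The representation in the chart at `x₀` of a `k`-form `θ`: its pullback by the inverse chart,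
a form on the target of the chart. -/
def chartForm {k : ℕ} (θ : Π x : M, Tan E x [⋀^Fin k]→L[ℝ] ℝ) (x₀ : M) (y : E) :
    E [⋀^Fin k]→L[ℝ] ℝ :=
  (θ ((extChartAt 𝓘(ℝ, E) x₀).symm y)).compContinuousLinearMap
    (mfderiv 𝓘(ℝ, E) 𝓘(ℝ, E) (extChartAt 𝓘(ℝ, E) x₀).symm y)

/-- Smooth `k`-forms: the representations in all the (preferred) charts are smooth. -/
def IsSmoothForm {k : ℕ} (θ : Π x : M, Tan E x [⋀^Fin k]→L[ℝ] ℝ) : Prop :=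
  ∀ x₀ : M, ContDiffOn ℝ ∞ (chartForm θ x₀) (extChartAt 𝓘(ℝ, E) x₀).target

/-- The exterior derivative `dθ` of a `k`-form: at `x`, it is the pullback by the chart at `x` of
the exterior derivative of the representation of `θ` in that chart. -/
def extD {k : ℕ} (θ : Π x : M, Tan E x [⋀^Fin k]→L[ℝ] ℝ) (x : M) :
    Tan E x [⋀^Fin (k + 1)]→L[ℝ] ℝ :=
  ContinuousAlternatingMap.compContinuousLinearMap (M' := E)
    (extDeriv (chartForm θ x) (extChartAt 𝓘(ℝ, E) x x))
    (mfderiv 𝓘(ℝ, E) 𝓘(ℝ, E) (extChartAt 𝓘(ℝ, E) x) x)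

/-- A covector field regarded as a differential form of degree one. -/
def oneForm (α : Π x : M, Cotan E x) (x : M) : Tan E x [⋀^Fin 1]→L[ℝ] ℝ :=
  ContinuousAlternatingMap.ofSubsingleton ℝ (Tan E x) ℝ 0 (α x)

/-- The covector `ι_X θ = θ(X, ·)` for an alternating bilinear form `θ`. -/
def contract₂ {V : Type*} [AddCommGroup V] [Module ℝ V] [TopologicalSpace V]
    (θ : V [⋀^Fin 2]→L[ℝ] ℝ) (X : V) : V →L[ℝ] ℝ :=
  θ.toContinuousMultilinearMap.toContinuousLinearMap ![X, 0] 1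

theorem contract₂_apply {V : Type*} [AddCommGroup V] [Module ℝ V] [TopologicalSpace V]
    (θ : V [⋀^Fin 2]→L[ℝ] ℝ) (X Z : V) : contract₂ θ X Z = θ ![X, Z] := by
  have h : Function.update ![X, (0 : V)] 1 Z = ![X, Z] := by
    ext i; fin_cases i <;> simp
  simp [contract₂, ← h]

/-- The covector `ι_Y ι_X θ = θ(X, Y, ·)` for an alternating trilinear form `θ`. -/
def contract₃ {V : Type*} [AddCommGroup V] [Module ℝ V] [TopologicalSpace V]
    (θ : V [⋀^Fin 3]→L[ℝ] ℝ) (X Y : V) : V →L[ℝ] ℝ :=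
  θ.toContinuousMultilinearMap.toContinuousLinearMap ![X, Y, 0] 2

theorem contract₃_apply {V : Type*} [AddCommGroup V] [Module ℝ V] [TopologicalSpace V]
    (θ : V [⋀^Fin 3]→L[ℝ] ℝ) (X Y Z : V) : contract₃ θ X Y Z = θ ![X, Y, Z] := by
  have h : Function.update ![X, Y, (0 : V)] 2 Z = ![X, Y, Z] := by
    ext i; fin_cases i <;> simp
  simp [contract₃, ← h]

/-- The two-form `(X, Y) ↦ B(X)(Y)` defined by a map `B : T → T*` with `B(X)(X) = 0`. -/
def twoForm [FiniteDimensional ℝ E] {x : M} (B : Tan E x →ₗ[ℝ] Cotan E x)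
    (hB : ∀ X, B X X = 0) : Tan E x [⋀^Fin 2]→L[ℝ] ℝ where
  toFun v := B (v 0) (v 1)
  map_update_add' v i X Y := by
    fin_cases i <;> simp
  map_update_smul' v i c X := by
    fin_cases i <;> simp
  map_eq_zero_of_eq' v i j h hij := by
    have h01 : v 0 = v 1 := by
      fin_cases i <;> fin_cases j <;> simp_all
    simp [h01, hB]
  cont := by
    let B' : E →L[ℝ] E →L[ℝ] ℝ := LinearMap.toContinuousLinearMap (E := E) B
    exact B'.continuous₂.comp ((continuous_apply (A := fun _ : Fin 2 => E) 0).prodMk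
      (continuous_apply (A := fun _ : Fin 2 => E) 1))

/-- The differential `df` of a function. -/
def differential (f : M → ℝ) (x : M) : Cotan E x :=
  mfderiv 𝓘(ℝ, E) 𝓘(ℝ, ℝ) f x

/-- The Lie derivative of a covector field, `L_X β = d(β(X)) + ι_X dβ`. -/
def lieDerivCovector (X : Π x : M, Tan E x) (β : Π x : M, Cotan E x) (x : M) : Cotan E x :=
  differential (fun y => β y (X y)) x + contract₂ (extD (oneForm β) x) (X x)

/-! ### The Courant algebroid structure -/

/-- The pairing `⟨X + α, Y + β⟩ = α(Y) + β(X)`. -/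
def pairing {x : M} (u v : GenTan E x) : ℝ := u.2 v.1 + v.2 u.1

/-- The `H`-twisted Dorfman bracket
`[X + α, Y + β]_H = [X, Y] + L_X β - ι_Y dα + ι_Y ι_X H`. -/
def dorfman (H : Π x : M, Tan E x [⋀^Fin 3]→L[ℝ] ℝ) (u v : Π x : M, GenTan E x) (x : M) :
    GenTan E x :=
  (VectorField.mlieBracket 𝓘(ℝ, E) (fun y => (u y).1) (fun y => (v y).1) x,
    lieDerivCovector (fun y => (u y).1) (fun y => (v y).2) x
      - contract₂ (extD (oneForm (fun y => (u y).2)) x) (v x).1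
      + contract₃ (H x) (u x).1 (v x).1)

/-- The fibre at `x` of the eigenbundle of `A` for the eigenvalue `s`. -/
def eigenbundle (A : Π x : M, GenTan E x →L[ℝ] GenTan E x) (s : ℝ) (x : M) :
    Submodule ℝ (GenTan E x) :=
  Module.End.eigenspace (A x : GenTan E x →ₗ[ℝ] GenTan E x) s

/-- A subbundle `L` of `T ⊕ T*` is involutive if `[Γ(L), Γ(L)]_H ⊆ Γ(L)`. -/
def IsInvolutive [IsManifold 𝓘(ℝ, E) ∞ M] (H : Π x : M, Tan E x [⋀^Fin 3]→L[ℝ] ℝ)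
    (L : Π x : M, Submodule ℝ (GenTan E x)) : Prop :=
  ∀ u v : Π x : M, GenTan E x, IsSmoothSection u → IsSmoothSection v →
    (∀ x, u x ∈ L x) → (∀ x, v x ∈ L x) → ∀ x, dorfman H u v x ∈ L x

/-! ### Generalized structures -/

/-- Generalized almost para-complex structures: `K² = 1` and `⟨K·, K·⟩ = -⟨·, ·⟩`. -/
structure IsGenAlmostParaComplex [IsManifold 𝓘(ℝ, E) ∞ M]
    (K : Π x : M, GenTan E x →L[ℝ] GenTan E x) : Prop where
  smooth : IsSmoothEnd K
  sq : ∀ x u, K x (K x u) = u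
  anti : ∀ x u v, pairing (K x u) (K x v) = -pairing u v

/-- A generalized almost para-complex structure is integrable if both of its eigenbundles are
involutive under the (twisted) Dorfman bracket. -/
def IsGenIntegrable [IsManifold 𝓘(ℝ, E) ∞ M] (H : Π x : M, Tan E x [⋀^Fin 3]→L[ℝ] ℝ)
    (K : Π x : M, GenTan E x →L[ℝ] GenTan E x) : Prop :=
  IsInvolutive H (eigenbundle K 1) ∧ IsInvolutive H (eigenbundle K (-1))

/-- The restriction to the `s`-eigenbundle of `A` of the projection `T ⊕ T* → T`, at `x`. -/
def projEigen (A : Π x : M, GenTan E x →L[ℝ] GenTan E x) (s : ℝ) (x : M) :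
    eigenbundle A s x →ₗ[ℝ] Tan E x :=
  (LinearMap.fst ℝ (Tan E x) (Cotan E x)).domRestrict (eigenbundle A s x)

/-- Generalized (indefinite) metrics: generalized product structures, `G² = 1` and
`⟨G·, G·⟩ = ⟨·, ·⟩`, which are non-degenerate, that is, whose two eigenbundles are mapped
isomorphically to `T` by the projection `T ⊕ T* → T`. -/
structure IsGenMetric [IsManifold 𝓘(ℝ, E) ∞ M]
    (G : Π x : M, GenTan E x →L[ℝ] GenTan E x) : Prop where
  smooth : IsSmoothEnd G
  sq : ∀ x u, G x (G x u) = u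
  orth : ∀ x u v, pairing (G x u) (G x v) = pairing u v
  nondegPlus : ∀ x, Function.Bijective (projEigen G 1 x)
  nondegMinus : ∀ x, Function.Bijective (projEigen G (-1) x)

variable (E M) in
/-- Generalized almost para-Kähler structures: commuting pairs of a generalized metric `G` and a
generalized almost para-complex structure `KPlus`. -/
structure GenAlmostParaKahler [IsManifold 𝓘(ℝ, E) ∞ M] where
  G : Π x : M, GenTan E x →L[ℝ] GenTan E x
  KPlus : Π x : M, GenTan E x →L[ℝ] GenTan E x
  metric : IsGenMetric G
  paraComplex : IsGenAlmostParaComplex KPlus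
  comm : ∀ x u, G x (KPlus x u) = KPlus x (G x u)

namespace GenAlmostParaKahler

variable [IsManifold 𝓘(ℝ, E) ∞ M] (S : GenAlmostParaKahler E M)

/-- The second generalized almost para-complex structure, `K₋ = G K₊`. -/
def KMinus (x : M) : GenTan E x →L[ℝ] GenTan E x := (S.G x).comp (S.KPlus x)

/-- Integrability of the pair `(K₊, K₋)`: both structures are integrable with respect to the
`H`-twisted Dorfman bracket. -/
def IsIntegrable (H : Π x : M, Tan E x [⋀^Fin 3]→L[ℝ] ℝ) : Prop :=
  IsGenIntegrable H S.KPlus ∧ IsGenIntegrable H S.KMinus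

/-! ### The induced data on the tangent bundle -/

/-- The inverse `π₊⁻¹ : T → C₊ ⊆ T ⊕ T*` of the projection restricted to the `+1`-eigenbundle of
the generalized metric. -/
def piPlusInv (x : M) : Tan E x →ₗ[ℝ] GenTan E x :=
  (eigenbundle S.G 1 x).subtype ∘ₗ
    (LinearEquiv.ofBijective (projEigen S.G 1 x) (S.metric.nondegPlus x)).symm.toLinearMap

/-- The inverse `π₋⁻¹ : T → C₋ ⊆ T ⊕ T*` of the projection restricted to the `-1`-eigenbundle of
the generalized metric. -/
def piMinusInv (x : M) : Tan E x →ₗ[ℝ] GenTan E x :=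
  (eigenbundle S.G (-1) x).subtype ∘ₗ
    (LinearEquiv.ofBijective (projEigen S.G (-1) x) (S.metric.nondegMinus x)).symm.toLinearMap

theorem fst_piPlusInv (x : M) (X : Tan E x) : (S.piPlusInv x X).1 = X :=
  (LinearEquiv.ofBijective (projEigen S.G 1 x) (S.metric.nondegPlus x)).apply_symm_apply X

theorem fst_piMinusInv (x : M) (X : Tan E x) : (S.piMinusInv x X).1 = X :=
  (LinearEquiv.ofBijective (projEigen S.G (-1) x) (S.metric.nondegMinus x)).apply_symm_apply X

theorem G_piPlusInv (x : M) (X : Tan E x) : S.G x (S.piPlusInv x X) = S.piPlusInv x X := by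
  have h := ((LinearEquiv.ofBijective (projEigen S.G 1 x)
    (S.metric.nondegPlus x)).symm X).2
  exact (Module.End.mem_eigenspace_iff.mp h).trans (one_smul ℝ _)

theorem G_piMinusInv (x : M) (X : Tan E x) : S.G x (S.piMinusInv x X) = -S.piMinusInv x X := by
  have h := ((LinearEquiv.ofBijective (projEigen S.G (-1) x)
    (S.metric.nondegMinus x)).symm X).2
  exact (Module.End.mem_eigenspace_iff.mp h).trans ((neg_smul _ _).trans (congrArg _ (one_smul ℝ _)))

/-- The metric `η : T → T*` of the generalized metric; together with `b` it is determined by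
`π±⁻¹ X = X + (b ± η) X`. -/
def eta (x : M) : Tan E x →ₗ[ℝ] Cotan E x :=
  (1 / 2 : ℝ) • (LinearMap.snd ℝ (Tan E x) (Cotan E x) ∘ₗ S.piPlusInv x
    - LinearMap.snd ℝ (Tan E x) (Cotan E x) ∘ₗ S.piMinusInv x)

/-- The two-form of the generalized metric, as a map `b : T → T*`, `b(X) = ι_X b`. -/
def bMap (x : M) : Tan E x →ₗ[ℝ] Cotan E x :=
  (1 / 2 : ℝ) • (LinearMap.snd ℝ (Tan E x) (Cotan E x) ∘ₗ S.piPlusInv x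
    + LinearMap.snd ℝ (Tan E x) (Cotan E x) ∘ₗ S.piMinusInv x)

theorem pairing_plus_minus (x : M) (X Y : Tan E x) :
    pairing (S.piPlusInv x X) (S.piMinusInv x Y) = 0 := by
  have h := S.metric.orth x (S.piPlusInv x X) (S.piMinusInv x Y)
  rw [S.G_piPlusInv, S.G_piMinusInv] at h
  simp only [pairing, Prod.fst_neg, Prod.snd_neg, map_neg, _root_.neg_apply] at h ⊢
  linarith

theorem bMap_self (x : M) (X : Tan E x) : S.bMap x X X = 0 := by
  have h := S.pairing_plus_minus x X X
  simp only [pairing, fst_piPlusInv, fst_piMinusInv] at h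
  simp only [bMap, LinearMap.smul_apply, LinearMap.add_apply, LinearMap.comp_apply,
    LinearMap.snd_apply, _root_.smul_apply, _root_.add_apply, smul_eq_mul, h, mul_zero]

theorem eta_eq_plus (x : M) (X Y : Tan E x) :
    S.eta x X Y = 1 / 2 * pairing (S.piPlusInv x X) (S.piPlusInv x Y) := by
  have h := S.pairing_plus_minus x Y X
  simp only [pairing, fst_piPlusInv, fst_piMinusInv] at h
  simp only [eta, pairing, fst_piPlusInv, LinearMap.smul_apply, LinearMap.sub_apply,
    LinearMap.comp_apply, LinearMap.snd_apply, _root_.smul_apply,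
    _root_.sub_apply, smul_eq_mul]
  linarith

theorem eta_eq_minus (x : M) (X Y : Tan E x) :
    S.eta x X Y = -(1 / 2) * pairing (S.piMinusInv x X) (S.piMinusInv x Y) := by
  have h := S.pairing_plus_minus x X Y
  simp only [pairing, fst_piPlusInv, fst_piMinusInv] at h
  simp only [eta, pairing, fst_piMinusInv, LinearMap.smul_apply, LinearMap.sub_apply,
    LinearMap.comp_apply, LinearMap.snd_apply, _root_.smul_apply,
    _root_.sub_apply, smul_eq_mul]
  linarith

theorem pairing_KPlus_self (x : M) (u : GenTan E x) : pairing (S.KPlus x u) u = 0 := by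
  have h := S.paraComplex.anti x (S.KPlus x u) u
  rw [S.paraComplex.sq] at h
  simp only [pairing] at h ⊢
  linarith

variable [FiniteDimensional ℝ E]

/-- The almost para-complex structure `K₊ = π₊ 𝒦₊ π₊⁻¹` of the tangent bundle. -/
def tanKPlus (x : M) : Tan E x →L[ℝ] Tan E x :=
  LinearMap.toContinuousLinearMap (LinearMap.fst ℝ (Tan E x) (Cotan E x) ∘ₗ
    (S.KPlus x : GenTan E x →ₗ[ℝ] GenTan E x) ∘ₗ S.piPlusInv x)

/-- The almost para-complex structure `K₋ = π₋ 𝒦₊ π₋⁻¹ = -π₋ 𝒦₋ π₋⁻¹` of the tangent bundle. -/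
def tanKMinus (x : M) : Tan E x →L[ℝ] Tan E x :=
  LinearMap.toContinuousLinearMap (LinearMap.fst ℝ (Tan E x) (Cotan E x) ∘ₗ
    (S.KPlus x : GenTan E x →ₗ[ℝ] GenTan E x) ∘ₗ S.piMinusInv x)

theorem piPlusInv_tanKPlus (x : M) (X : Tan E x) :
    S.piPlusInv x (S.tanKPlus x X) = S.KPlus x (S.piPlusInv x X) := by
  have hm : S.KPlus x (S.piPlusInv x X) ∈ eigenbundle S.G 1 x := by
    refine Module.End.mem_eigenspace_iff.mpr ?_
    exact ((S.comm x _).trans (congrArg _ (S.G_piPlusInv x X))).trans (one_smul ℝ _).symm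
  have h : S.tanKPlus x X = projEigen S.G 1 x ⟨_, hm⟩ := rfl
  rw [h]
  exact congrArg Subtype.val ((LinearEquiv.ofBijective (projEigen S.G 1 x)
    (S.metric.nondegPlus x)).symm_apply_apply ⟨_, hm⟩)

theorem piMinusInv_tanKMinus (x : M) (X : Tan E x) :
    S.piMinusInv x (S.tanKMinus x X) = S.KPlus x (S.piMinusInv x X) := by
  have hm : S.KPlus x (S.piMinusInv x X) ∈ eigenbundle S.G (-1) x := by
    refine Module.End.mem_eigenspace_iff.mpr ?_
    rw [neg_smul, one_smul]
    exact ((S.comm x _).trans (congrArg _ (S.G_piMinusInv x X))).trans (map_neg (S.KPlus x) _)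
  have h : S.tanKMinus x X = projEigen S.G (-1) x ⟨_, hm⟩ := rfl
  rw [h]
  exact congrArg Subtype.val ((LinearEquiv.ofBijective (projEigen S.G (-1) x)
    (S.metric.nondegMinus x)).symm_apply_apply ⟨_, hm⟩)

theorem eta_tanKPlus_self (x : M) (X : Tan E x) : S.eta x (S.tanKPlus x X) X = 0 := by
  rw [eta_eq_plus, piPlusInv_tanKPlus, pairing_KPlus_self, mul_zero]

theorem eta_tanKMinus_self (x : M) (X : Tan E x) : S.eta x (S.tanKMinus x X) X = 0 := by
  rw [eta_eq_minus, piMinusInv_tanKMinus, pairing_KPlus_self, mul_zero]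

/-- The two-form `b(X, Y) = b(X)(Y)`. -/
def b (x : M) : Tan E x [⋀^Fin 2]→L[ℝ] ℝ :=
  twoForm (S.bMap x) (S.bMap_self x)

/-- The fundamental form `ω₊ = η K₊`, that is, `ω₊(X, Y) = η(K₊ X, Y)`. -/
def omegaPlus (x : M) : Tan E x [⋀^Fin 2]→L[ℝ] ℝ :=
  twoForm (S.eta x ∘ₗ (S.tanKPlus x : Tan E x →ₗ[ℝ] Tan E x)) (S.eta_tanKPlus_self x)

/-- The fundamental form `ω₋ = η K₋`, that is, `ω₋(X, Y) = η(K₋ X, Y)`. -/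
def omegaMinus (x : M) : Tan E x [⋀^Fin 2]→L[ℝ] ℝ :=
  twoForm (S.eta x ∘ₗ (S.tanKMinus x : Tan E x →ₗ[ℝ] Tan E x)) (S.eta_tanKMinus_self x)

end GenAlmostParaKahler

/-! ### Para-complex structures on the tangent bundle -/

/-- The Nijenhuis tensor `N_K(X, Y) = [X, Y] + [KX, KY] - K([KX, Y] + [X, KY])`. -/
def nijenhuis (K : Π x : M, Tan E x →L[ℝ] Tan E x) (X Y : Π x : M, Tan E x) (x : M) : Tan E x :=
  VectorField.mlieBracket 𝓘(ℝ, E) X Y x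
    + VectorField.mlieBracket 𝓘(ℝ, E) (fun y => K y (X y)) (fun y => K y (Y y)) x
    - K x (VectorField.mlieBracket 𝓘(ℝ, E) (fun y => K y (X y)) Y x
      + VectorField.mlieBracket 𝓘(ℝ, E) X (fun y => K y (Y y)) x)

/-- An almost para-complex structure is integrable if its Nijenhuis tensor vanishes. -/
def IsIntegrableParaComplex [IsManifold 𝓘(ℝ, E) ∞ M]
    (K : Π x : M, Tan E x →L[ℝ] Tan E x) : Prop :=
  ∀ X Y : Π x : M, Tan E x, IsSmoothField X → IsSmoothField Y → ∀ x, nijenhuis K X Y x = 0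

/-- The action `(ΛᵏK θ)(X₁, …, X_k) = θ(K X₁, …, K X_k)` of `K` on `k`-forms. -/
def formAction {k : ℕ} (K : Π x : M, Tan E x →L[ℝ] Tan E x)
    (θ : Π x : M, Tan E x [⋀^Fin k]→L[ℝ] ℝ) (x : M) : Tan E x [⋀^Fin k]→L[ℝ] ℝ :=
  (θ x).compContinuousLinearMap (K x)

/-- The twisted differential `dᵖ = Λᵏ⁺¹K ∘ d ∘ ΛᵏK` of an almost para-complex structure `K`. -/
def dP {k : ℕ} (K : Π x : M, Tan E x →L[ℝ] Tan E x)
    (θ : Π x : M, Tan E x [⋀^Fin k]→L[ℝ] ℝ) : Π x : M, Tan E x [⋀^Fin (k + 1)]→L[ℝ] ℝ :=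
  formAction K (extD (formAction K θ))

end GenGeom

end

noncomputable section

namespace GenGeom

/-! ### Smooth sections -/

section

variable {E : Type*} [NormedAddCommGroup E] [NormedSpace ℝ E]
  {M : Type*} [TopologicalSpace M] [ChartedSpace E M] [IsManifold 𝓘(ℝ, E) ∞ M]

/-! Write `lift e X = X + (b + eη)X` for e = ±1, so that the e-eigenbundle of 𝒢 is the image of
`lift e`, and let T_e^s be the s-eigenbundle of K_e in T, where K_e means K_+ or K_-. Since 𝒢 and
𝒦_+ commute, T ⊕ T* splits into four bundles `lift e` (T_e^s). Each is the intersection of the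
s-eigenbundle of 𝒦_+ with the es-eigenbundle of 𝒦_-, and each eigenbundle of 𝒦_± is a sum of two of
them.

Integrability is equivalent to involutivity of these four bundles. One direction holds because
intersections of involutive bundles are involutive. For the converse, each eigenbundle of 𝒦_± is its
own annihilator, and on mutually isotropic sections ⟨[u,v],w⟩ is invariant under cyclic permutation
(`pairing_dorfman_cycle`). Among three sections taken from two summands, two lie in the same
summand, and a rotation puts them inside the bracket (`isInvolutive_of_isGood`).

Involutivity of one summand is read off from `IsHalf.pairing_dorfman_lift`: for X, Y and [X,Y] in
T_e^s and any Z, the pairing of [lift e X, lift e Y] with lift e' Z is (H + db + es dω)(X,Y,Z) +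
(e+e')η([X,Y],Z). Hence the summand is involutive exactly when T_e^s is involutive and H + db + es
dω vanishes on T_e^s × T_e^s × T; this is `IsGood`.

Involutivity of T_e^s for both signs s is the vanishing of the Nijenhuis tensor of K_e. Then dω
vanishes on triples from a single T_e^s, since these bundles are η-isotropic and involutive, and the
remaining condition becomes (Λ³K)dω = e(H + db) (`isGood_iff`). As (Λ²K)ω = -ω, this says dᵖω = -e(H
+ db), which is condition 2 for the two signs.

The analytic input is the smoothness of `lift e X` and the expression of d through global vector
fields (`extD_apply_fields`). -/

theorem IsSmoothSection.add {u v : Π x : M, GenTan E x} (hu : IsSmoothSection u)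
    (hv : IsSmoothSection v) : IsSmoothSection (u + v) :=
  ContMDiff.add_section (V := GenBundle E M) hu hv

theorem IsSmoothSection.sub {u v : Π x : M, GenTan E x} (hu : IsSmoothSection u)
    (hv : IsSmoothSection v) : IsSmoothSection (u - v) :=
  ContMDiff.sub_section (V := GenBundle E M) hu hv

theorem IsSmoothSection.const_smul {u : Π x : M, GenTan E x} (c : ℝ) (hu : IsSmoothSection u) :
    IsSmoothSection (c • u) :=
  ContMDiff.const_smul_section (V := GenBundle E M) hu

theorem IsSmoothField.add {X Y : Π x : M, Tan E x} (hX : IsSmoothField X)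
    (hY : IsSmoothField Y) : IsSmoothField (X + Y) :=
  ContMDiff.add_section (V := fun x : M => Tan E x) hX hY

theorem IsSmoothField.const_smul {X : Π x : M, Tan E x} (c : ℝ) (hX : IsSmoothField X) :
    IsSmoothField (c • X) :=
  ContMDiff.const_smul_section (V := fun x : M => Tan E x) hX

theorem IsSmoothEnd.apply {A : Π x : M, GenTan E x →L[ℝ] GenTan E x} {u : Π x : M, GenTan E x}
    (hA : IsSmoothEnd A) (hu : IsSmoothSection u) : IsSmoothSection (fun x => A x (u x)) :=
  ContMDiff.clm_bundle_apply (E₁ := GenBundle E M) (E₂ := GenBundle E M) hA hu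

/-- Smooth covector fields. -/
def IsSmoothCofield (α : Π x : M, Cotan E x) : Prop :=
  ContMDiff 𝓘(ℝ, E) (𝓘(ℝ, E).prod 𝓘(ℝ, E →L[ℝ] ℝ)) ∞
    (fun x => Bundle.TotalSpace.mk' (E →L[ℝ] ℝ) (E := fun y : M => Cotan E y) x (α x))

theorem isSmoothSection_iff {u : Π x : M, GenTan E x} :
    IsSmoothSection u ↔ IsSmoothField (fun x => (u x).1) ∧ IsSmoothCofield (fun x => (u x).2) := by
  unfold IsSmoothSection IsSmoothField IsSmoothCofield ContMDiff
  rw [← forall_and]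
  refine forall_congr' fun x => ?_
  rw [Bundle.contMDiffAt_section, Bundle.contMDiffAt_section, Bundle.contMDiffAt_section]
  exact contMDiffAt_prod_module_iff _

theorem IsSmoothCofield.apply {α : Π x : M, Cotan E x} {X : Π x : M, Tan E x}
    (hα : IsSmoothCofield α) (hX : IsSmoothField X) :
    ContMDiff 𝓘(ℝ, E) 𝓘(ℝ, ℝ) ∞ (fun x => α x (X x)) := by
  have h := ContMDiff.clm_bundle_apply (E₁ := fun x : M => Tan E x) (E₂ := fun _ : M => ℝ) hα hX
  intro x
  exact (Bundle.contMDiffAt_section _).1 (h x)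

theorem IsSmoothSection.pairing {u v : Π x : M, GenTan E x} (hu : IsSmoothSection u)
    (hv : IsSmoothSection v) :
    ContMDiff 𝓘(ℝ, E) 𝓘(ℝ, ℝ) ∞ (fun x => pairing (u x) (v x)) := by
  rw [isSmoothSection_iff] at hu hv
  exact (hu.2.apply hv.1).add (hv.2.apply hu.1)

/-- A bump function cuts off the field that is constant in the trivialization at x₀. The conclusion
concerns the germ, not just the value, because these fields are used to differentiate coefficients
of forms. -/
theorem exists_isSmoothField_eventuallyEq [FiniteDimensional ℝ E] [T2Space M] (x₀ : M) (e : E) :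
    ∃ X : Π x : M, Tan E x, IsSmoothField X ∧ ∀ᶠ x in nhds x₀,
      X x = (trivializationAt E (TangentSpace 𝓘(ℝ, E)) x₀).symm x e := by
  obtain ⟨f⟩ : Nonempty (SmoothBumpFunction 𝓘(ℝ, E) x₀) := inferInstance
  refine ⟨fun x => f x • (trivializationAt E (TangentSpace 𝓘(ℝ, E)) x₀).symm x e, ?_, ?_⟩
  · refine ContMDiffOn.smul_section_of_tsupport (V := fun x : M => Tan E x) f.contMDiff.contMDiffOn
      (trivializationAt E (TangentSpace 𝓘(ℝ, E)) x₀).open_baseSet f.tsupport_subset_chartAt_source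
      fun x hx => ?_
    rw [Bundle.Trivialization.contMDiffWithinAt_section _ hx]
    refine (contMDiffOn_const (c := e)).congr (fun y hy => ?_) x hx
    exact congrArg Prod.snd (Bundle.Trivialization.apply_mk_symm _ hy e)
  · filter_upwards [f.eventuallyEq_one] with x hx
    simp [hx]

theorem exists_isSmoothField_eq [FiniteDimensional ℝ E] [T2Space M] (x₀ : M) (v : Tan E x₀) :
    ∃ X : Π x : M, Tan E x, IsSmoothField X ∧ X x₀ = v := by
  obtain ⟨X, hX, h⟩ := exists_isSmoothField_eventuallyEq x₀
    (trivializationAt E (TangentSpace 𝓘(ℝ, E)) x₀ ⟨x₀, v⟩).2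
  exact ⟨X, hX, h.self_of_nhds.trans (Bundle.Trivialization.symm_apply_apply_mk _
    (FiberBundle.mem_baseSet_trivializationAt' x₀) v)⟩

/-- Identifies the derivative occurring in `chartForm` with the inverse tangent trivialization, so
that forms and fields are represented in the same frame. -/
theorem mfderiv_extChartAt_symm {x₀ x : M} (hx : x ∈ (chartAt E x₀).source) (e : E) :
    mfderiv 𝓘(ℝ, E) 𝓘(ℝ, E) (extChartAt 𝓘(ℝ, E) x₀).symm (extChartAt 𝓘(ℝ, E) x₀ x) e =
      (trivializationAt E (TangentSpace 𝓘(ℝ, E)) x₀).symm x e := by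
  have : IsManifold 𝓘(ℝ, E) 1 M := .of_le (n := ∞) (by simp)
  have h := TangentBundle.symmL_trivializationAt (I := 𝓘(ℝ, E)) hx
  simp only [modelWithCornersSelf_coe, Set.range_id, mfderivWithin_univ] at h
  have h' := congrArg (fun A => A e) h
  rw [Bundle.Trivialization.symmL_apply _ (by exact hx)] at h'
  exact h'.symm

end

/-! ### The exterior derivative in terms of vector fields -/

section

variable {E : Type*} [NormedAddCommGroup E] [NormedSpace ℝ E]
  {M : Type*} [TopologicalSpace M] [ChartedSpace E M]

theorem differential_eq_fderiv_comp_extChartAt_symm {f : M → ℝ} (hf : ContMDiff 𝓘(ℝ, E) 𝓘(ℝ, ℝ) ∞ f)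
    (x : M) (v : Tan E x) : differential f x v =
      fderiv ℝ (fun y => f ((extChartAt 𝓘(ℝ, E) x).symm y)) (extChartAt 𝓘(ℝ, E) x x) v := by
  have h := hf.mdifferentiableAt (x := x) (by simp)
  simp only [differential, mfderiv, h, modelWithCornersSelf_coe, Set.range_id, fderivWithin_univ]
  rfl

variable [IsManifold 𝓘(ℝ, E) ∞ M]

/-- Forms whose values on smooth vector fields are smooth functions. -/
def IsSmoothOnFields {k : ℕ} (θ : Π x : M, Tan E x [⋀^Fin k]→L[ℝ] ℝ) : Prop :=
  ∀ X : Fin k → Π x : M, Tan E x, (∀ i, IsSmoothField (X i)) →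
    ContMDiff 𝓘(ℝ, E) 𝓘(ℝ, ℝ) ∞ (fun x => θ x (fun i => X i x))

theorem finiteDimensional_continuousAlternatingMap [FiniteDimensional ℝ E] {k : ℕ} :
    FiniteDimensional ℝ (E [⋀^Fin k]→L[ℝ] ℝ) := by
  let b := Module.finBasis ℝ E
  let ev : (E [⋀^Fin k]→L[ℝ] ℝ) →ₗ[ℝ] ((Fin k → Fin (Module.finrank ℝ E)) → ℝ) :=
    { toFun := fun θ s => θ (fun i => b (s i))
      map_add' := fun _ _ => rfl
      map_smul' := fun _ _ => rfl }
  refine FiniteDimensional.of_injective ev fun θ θ' h => ?_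
  apply ContinuousAlternatingMap.toAlternatingMap_injective
  exact Module.Basis.ext_alternating b fun v _ => congrFun h v

/-- An alternating form is determined linearly by its finitely many values on tuples of basis
vectors. A linear left inverse of that evaluation is continuous in finite dimension and recovers f
from its coefficients. -/
theorem differentiableAt_continuousAlternatingMap [FiniteDimensional ℝ E] {k : ℕ}
    {F : Type*} [NormedAddCommGroup F] [NormedSpace ℝ F] {f : F → E [⋀^Fin k]→L[ℝ] ℝ} {y : F}
    (hf : ∀ e : Fin k → E, DifferentiableAt ℝ (fun z => f z e) y) : DifferentiableAt ℝ f y := by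
  have := finiteDimensional_continuousAlternatingMap (E := E) (k := k)
  let b := Module.finBasis ℝ E
  let ev : (E [⋀^Fin k]→L[ℝ] ℝ) →ₗ[ℝ] ((Fin k → Fin (Module.finrank ℝ E)) → ℝ) :=
    { toFun := fun θ s => θ (fun i => b (s i))
      map_add' := fun _ _ => rfl
      map_smul' := fun _ _ => rfl }
  have hev : LinearMap.ker ev = ⊥ := LinearMap.ker_eq_bot.2 fun θ θ' h =>
    ContinuousAlternatingMap.toAlternatingMap_injective
      (Module.Basis.ext_alternating b fun v _ => congrFun h v)
  obtain ⟨g, hg⟩ := ev.exists_leftInverse_of_injective hev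
  have h1 : f = fun z => LinearMap.toContinuousLinearMap g (ev (f z)) := by
    funext z
    exact (LinearMap.congr_fun hg (f z)).symm
  rw [h1]
  exact (LinearMap.toContinuousLinearMap g).differentiableAt.comp y
    (differentiableAt_pi.2 fun s => hf _)

theorem differentiableAt_comp_extChartAt_symm {f : M → ℝ} (hf : ContMDiff 𝓘(ℝ, E) 𝓘(ℝ, ℝ) ∞ f)
    (x : M) : DifferentiableAt ℝ (fun y => f ((extChartAt 𝓘(ℝ, E) x).symm y))
      (extChartAt 𝓘(ℝ, E) x x) := by
  have h := hf.comp_contMDiffOn (contMDiffOn_extChartAt_symm (I := 𝓘(ℝ, E)) (n := ∞) x)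
  rw [contMDiffOn_iff_contDiffOn] at h
  exact (h.contDiffAt (extChartAt_target_mem_nhds x)).differentiableAt (by simp)

/-- The chart components P may depend on the point. Constant P gives the coefficients of θ; P equal
to the chart representations of given fields gives the functions differentiated in the formula for
dθ. -/
theorem eventually_chartForm_apply {k : ℕ} (θ : Π x : M, Tan E x [⋀^Fin k]→L[ℝ] ℝ)
    (X : Fin k → Π x : M, Tan E x) (x₀ : M) (P : E → Fin k → E)
    (hP : ∀ i, ∀ᶠ x in nhds x₀, X i x = (trivializationAt E (TangentSpace 𝓘(ℝ, E)) x₀).symm x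
      (P (extChartAt 𝓘(ℝ, E) x₀ x) i)) :
    ∀ᶠ y in nhds (extChartAt 𝓘(ℝ, E) x₀ x₀), chartForm θ x₀ y (P y) =
      θ ((extChartAt 𝓘(ℝ, E) x₀).symm y) (fun i => X i ((extChartAt 𝓘(ℝ, E) x₀).symm y)) := by
  have h1 := (continuousAt_extChartAt_symm (I := 𝓘(ℝ, E)) x₀).eventually
    (p := fun x => ∀ i, X i x = (trivializationAt E (TangentSpace 𝓘(ℝ, E)) x₀).symm x
      (P (extChartAt 𝓘(ℝ, E) x₀ x) i))
    (by rw [extChartAt_to_inv, Filter.eventually_all]; exact hP)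
  filter_upwards [h1, extChartAt_target_mem_nhds (I := 𝓘(ℝ, E)) x₀] with y hy hyt
  have hs := (extChartAt 𝓘(ℝ, E) x₀).map_target hyt
  rw [extChartAt_source] at hs
  refine congrArg (θ ((extChartAt 𝓘(ℝ, E) x₀).symm y)) (funext fun i => ?_)
  have := mfderiv_extChartAt_symm hs (P y i)
  have hr := (extChartAt 𝓘(ℝ, E) x₀).right_inv hyt
  rw [hr] at this
  have hy' := hy i
  rw [hr] at hy'
  exact this.trans hy'.symm

theorem IsSmoothOnFields.differentiableAt_chartForm [FiniteDimensional ℝ E] [T2Space M] {k : ℕ}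
    {θ : Π x : M, Tan E x [⋀^Fin k]→L[ℝ] ℝ} (hθ : IsSmoothOnFields θ) (x : M) :
    DifferentiableAt ℝ (chartForm θ x) (extChartAt 𝓘(ℝ, E) x x) := by
  refine differentiableAt_continuousAlternatingMap fun e => ?_
  choose X hX hXe using fun i => exists_isSmoothField_eventuallyEq x (e i)
  refine (differentiableAt_comp_extChartAt_symm (hθ X hX) x).congr_of_eventuallyEq ?_
  exact eventually_chartForm_apply θ X x (fun _ => e) hXe

/-- The representation of a vector field in the chart at `x₀`. -/
def chartField (X : Π x : M, Tan E x) (x₀ : M) (y : E) : E :=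
  (trivializationAt E (TangentSpace 𝓘(ℝ, E)) x₀
    ⟨(extChartAt 𝓘(ℝ, E) x₀).symm y, X ((extChartAt 𝓘(ℝ, E) x₀).symm y)⟩).2

/-- At the centre of the chart the trivialization is the identity of the model space. This removes
every change-of-frame factor from the formulas at the base point. -/
theorem trivializationAt_self (x : M) (v : Tan E x) :
    (trivializationAt E (TangentSpace 𝓘(ℝ, E)) x ⟨x, v⟩).2 = v := by
  have : IsManifold 𝓘(ℝ, E) 1 M := .of_le (n := ∞) (by simp)
  have h1 := TangentBundle.continuousLinearMapAt_trivializationAt (I := 𝓘(ℝ, E))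
    (mem_chart_source E x)
  rw [mfderiv_extChartAt_self] at h1
  refine Eq.trans ?_ (congrArg (fun A => A v) h1)
  exact (Bundle.Trivialization.continuousLinearMapAt_apply_of_mem ℝ _
    (FiberBundle.mem_baseSet_trivializationAt' x) _).symm

theorem trivializationAt_symm_self (x : M) (v : Tan E x) :
    (trivializationAt E (TangentSpace 𝓘(ℝ, E)) x).symm x v = v := by
  conv_lhs => rw [← trivializationAt_self x v]
  exact Bundle.Trivialization.symm_apply_apply_mk _
    (FiberBundle.mem_baseSet_trivializationAt' x) v

theorem chartField_self (X : Π x : M, Tan E x) (x : M) :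
    chartField X x (extChartAt 𝓘(ℝ, E) x x) = X x := by
  rw [chartField, extChartAt_to_inv, trivializationAt_self]

theorem IsSmoothField.differentiableAt_chartField {X : Π x : M, Tan E x} (hX : IsSmoothField X)
    (x : M) : DifferentiableAt ℝ (chartField X x) (extChartAt 𝓘(ℝ, E) x x) := by
  have h := (Bundle.contMDiffAt_section x).1 (hX x)
  rw [← extChartAt_to_inv (I := 𝓘(ℝ, E)) x] at h
  have h1 := (contMDiffOn_extChartAt_symm (I := 𝓘(ℝ, E)) (n := ∞) x).contMDiffAt
    (extChartAt_target_mem_nhds x)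
  have h2 := ContMDiffAt.comp (extChartAt 𝓘(ℝ, E) x x) h h1
  rw [contMDiffAt_iff_contDiffAt, extChartAt_to_inv] at h2
  exact h2.differentiableAt (by simp)

theorem mlieBracket_eq_lieBracket_chartField (X Y : Π x : M, Tan E x) (x : M) :
    VectorField.mlieBracket 𝓘(ℝ, E) X Y x =
      VectorField.lieBracket ℝ (chartField X x) (chartField Y x) (extChartAt 𝓘(ℝ, E) x x) := by
  have : IsManifold 𝓘(ℝ, E) 1 M := .of_le (n := ∞) (by simp)
  have key : ∀ Z : Π x : M, Tan E x,
      VectorField.mpullback 𝓘(ℝ, E) 𝓘(ℝ, E) (extChartAt 𝓘(ℝ, E) x).symm Z =ᶠ[nhds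
        (extChartAt 𝓘(ℝ, E) x x)] chartField Z x := by
    intro Z
    filter_upwards [extChartAt_target_mem_nhds (I := 𝓘(ℝ, E)) x] with y hy
    have hs := (extChartAt 𝓘(ℝ, E) x).map_target hy
    rw [extChartAt_source] at hs
    have h1 := mfderivWithin_extChartAt_symm_comp_mfderiv_extChartAt hy
    have h2 := mfderiv_extChartAt_comp_mfderivWithin_extChartAt_symm hy
    have h3 := TangentBundle.continuousLinearMapAt_trivializationAt (I := 𝓘(ℝ, E)) hs
    simp only [modelWithCornersSelf_coe, Set.range_id, mfderivWithin_univ] at h1 h2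
    rw [VectorField.mpullback_apply, ContinuousLinearMap.inverse_eq h1 h2, ← h3]
    exact Bundle.Trivialization.continuousLinearMapAt_apply_of_mem ℝ _ (by exact hs) _
  rw [← VectorField.mlieBracketWithin_univ, VectorField.mlieBracketWithin_apply,
    mfderiv_extChartAt_self]
  simp only [modelWithCornersSelf_coe, Set.range_id, Set.preimage_univ, Set.univ_inter,
    VectorField.mpullbackWithin_univ]
  have hid : ∀ w : E, (ContinuousLinearMap.id ℝ E).inverse w = w := fun w => by
    rw [ContinuousLinearMap.inverse_id, ContinuousLinearMap.id_apply]
  refine (hid _).trans ?_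
  refine (congrFun VectorField.lieBracketWithin_univ _).trans ?_
  exact (key X).lieBracket_vectorField_eq (key Y)

/-- The derivative of the chart at its own centre is the identity, so the pullback in `extD` is
invisible at x. -/
theorem extD_apply {k : ℕ} (θ : Π x : M, Tan E x [⋀^Fin k]→L[ℝ] ℝ) (x : M)
    (v : Fin (k + 1) → Tan E x) :
    extD θ x v = extDeriv (chartForm θ x) (extChartAt 𝓘(ℝ, E) x x) v := by
  have : IsManifold 𝓘(ℝ, E) 1 M := .of_le (n := ∞) (by simp)
  unfold extD
  rw [mfderiv_extChartAt_self]
  rfl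

/-- The invariant formula for dθ is local: it is the vector-space formula in the chart at x, with
differentials of functions and Lie brackets transported back at the centre of the chart. -/
theorem extD_apply_fields [FiniteDimensional ℝ E] [T2Space M] {k : ℕ}
    {θ : Π x : M, Tan E x [⋀^Fin (k + 1)]→L[ℝ] ℝ} (hθ : IsSmoothOnFields θ)
    {X : Fin (k + 2) → Π x : M, Tan E x} (hX : ∀ i, IsSmoothField (X i)) (x : M) :
    extD θ x (fun i => X i x) =
      (∑ i, (-1) ^ i.val • differential (fun y => θ y (fun j => X (i.succAbove j) y)) x (X i x)) -
        ∑ i : Fin (k + 1), ∑ j ≥ i, (-1) ^ (i + j : ℕ) •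
          θ x (Matrix.vecCons (VectorField.mlieBracket 𝓘(ℝ, E) (X i.castSucc) (X j.succ) x)
            (fun l => X (i.castSucc.succAbove (j.succAbove l)) x)) := by
  have h := extDeriv_apply_vectorField (hθ.differentiableAt_chartForm x)
    (fun i => (hX i).differentiableAt_chartField x)
  have hself : ∀ i, chartField (X i) x (extChartAt 𝓘(ℝ, E) x x) = X i x :=
    fun i => chartField_self _ _
  -- Extending v by fields that are constant in the trivialization reduces the value at the centre
  -- to the identity of that trivialization on the fibre over x.
  have hθx : ∀ v : Fin (k + 1) → E, chartForm θ x (extChartAt 𝓘(ℝ, E) x x) v = θ x v := by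
    intro v
    choose Y hY hYv using fun i => exists_isSmoothField_eventuallyEq x (v i)
    refine (eventually_chartForm_apply θ Y x (fun _ => v) hYv).self_of_nhds.trans ?_
    rw [extChartAt_to_inv]
    refine congrArg (θ x) (funext fun i => (hYv i).self_of_nhds.trans ?_)
    exact trivializationAt_symm_self x (v i)
  simp only [hself, hθx] at h
  rw [extD_apply]
  refine h.trans ?_
  congr 1
  · refine Finset.sum_congr rfl fun i _ => ?_
    congr 1
    rw [differential_eq_fderiv_comp_extChartAt_symm (hθ _ fun j => hX _)]
    refine congrArg (fun A : E →L[ℝ] ℝ => A (X i x)) (Filter.EventuallyEq.fderiv_eq ?_)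
    refine eventually_chartForm_apply θ (fun j => X (i.succAbove j)) x
      (fun y j => chartField (X (i.succAbove j)) x y) fun j => ?_
    filter_upwards [extChartAt_source_mem_nhds (I := 𝓘(ℝ, E)) x] with y hy
    rw [chartField, (extChartAt 𝓘(ℝ, E) x).left_inv hy]
    rw [extChartAt_source] at hy
    exact (Bundle.Trivialization.symm_apply_apply_mk _ (by exact hy) _).symm
  · refine Finset.sum_congr rfl fun i _ => Finset.sum_congr rfl fun j _ => ?_
    rw [← mlieBracket_eq_lieBracket_chartField]
    rfl

theorem extD_oneForm_apply_fields [FiniteDimensional ℝ E] [T2Space M] {α : Π x : M, Cotan E x}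
    (hα : IsSmoothCofield α) {X Y : Π x : M, Tan E x} (hX : IsSmoothField X)
    (hY : IsSmoothField Y) (x : M) :
    extD (oneForm α) x ![X x, Y x] =
      differential (fun y => α y (Y y)) x (X x) - differential (fun y => α y (X y)) x (Y x)
        - α x (VectorField.mlieBracket 𝓘(ℝ, E) X Y x) := by
  have hθ : IsSmoothOnFields (oneForm α) := fun Z hZ => hα.apply (hZ 0)
  have h := extD_apply_fields hθ (X := ![X, Y]) (by simp [Fin.forall_fin_two, hX, hY]) x
  have hv : (fun i => (![X, Y] : Fin 2 → Π x : M, Tan E x) i x) = ![X x, Y x] := by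
    funext i; fin_cases i <;> rfl
  rw [hv] at h
  have e0 : ∀ y, (fun j => (![X, Y] : Fin 2 → Π x : M, Tan E x)
      (Fin.succAbove (0 : Fin 2) j) y) = ![Y y] := fun y => by funext j; fin_cases j; rfl
  have e1 : ∀ y, (fun j => (![X, Y] : Fin 2 → Π x : M, Tan E x)
      (Fin.succAbove (1 : Fin 2) j) y) = ![X y] := fun y => by funext j; fin_cases j; rfl
  have hs : Finset.Ici (0 : Fin 1) = {0} := rfl
  have ho : ∀ y v, oneForm α y ![v] = α y v := fun _ _ => rfl
  have hb : ∀ (v : Tan E x) (w : Fin 0 → Tan E x), oneForm α x (Matrix.vecCons v w) = α x v :=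
    fun _ _ => rfl
  have hX0 : (![X, Y] : Fin 2 → Π x : M, Tan E x) 0 = X := rfl
  have hX1 : (![X, Y] : Fin 2 → Π x : M, Tan E x) 1 = Y := rfl
  rw [h]
  simp only [Nat.reduceAdd, Fin.sum_univ_two, Fin.sum_univ_one, hs, Finset.sum_singleton, hb, e0, e1, ho, hX0, hX1,
    Fin.isValue, Fin.val_zero, Fin.val_one, pow_zero, pow_one, add_zero, Fin.castSucc_zero, Fin.succ_zero_eq_one, one_smul,
    neg_smul]
  ring

theorem extD_twoForm_apply_fields [FiniteDimensional ℝ E] [T2Space M]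
    {θ : Π x : M, Tan E x [⋀^Fin 2]→L[ℝ] ℝ} (hθ : IsSmoothOnFields θ)
    {X Y Z : Π x : M, Tan E x} (hX : IsSmoothField X) (hY : IsSmoothField Y)
    (hZ : IsSmoothField Z) (x : M) :
    extD θ x ![X x, Y x, Z x] =
      differential (fun y => θ y ![Y y, Z y]) x (X x)
        - differential (fun y => θ y ![X y, Z y]) x (Y x)
        + differential (fun y => θ y ![X y, Y y]) x (Z x)
        - θ x ![VectorField.mlieBracket 𝓘(ℝ, E) X Y x, Z x]
        + θ x ![VectorField.mlieBracket 𝓘(ℝ, E) X Z x, Y x]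
        - θ x ![VectorField.mlieBracket 𝓘(ℝ, E) Y Z x, X x] := by
  have h := extD_apply_fields hθ (X := ![X, Y, Z])
    (by simp [Fin.forall_fin_succ, hX, hY, hZ]) x
  have hv : (fun i => (![X, Y, Z] : Fin 3 → Π x : M, Tan E x) i x) = ![X x, Y x, Z x] := by
    funext i; fin_cases i <;> rfl
  rw [hv] at h
  have e0 : ∀ y, (fun j => (![X, Y, Z] : Fin 3 → Π x : M, Tan E x)
      (Fin.succAbove (0 : Fin 3) j) y) = ![Y y, Z y] := fun y => by
    funext j; fin_cases j <;> rfl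
  have e1 : ∀ y, (fun j => (![X, Y, Z] : Fin 3 → Π x : M, Tan E x)
      (Fin.succAbove (1 : Fin 3) j) y) = ![X y, Z y] := fun y => by
    funext j; fin_cases j <;> rfl
  have e2 : ∀ y, (fun j => (![X, Y, Z] : Fin 3 → Π x : M, Tan E x)
      (Fin.succAbove (2 : Fin 3) j) y) = ![X y, Y y] := fun y => by
    funext j; fin_cases j <;> rfl
  have hs0 : Finset.Ici (0 : Fin 2) = {0, 1} := rfl
  have hs1 : Finset.Ici (1 : Fin 2) = {1} := rfl
  have f00 : (fun l : Fin 1 => (![X, Y, Z] : Fin 3 → Π x : M, Tan E x)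
      ((0 : Fin 3).succAbove ((0 : Fin 2).succAbove l)) x) = ![Z x] := by
    funext j; fin_cases j; rfl
  have f01 : (fun l : Fin 1 => (![X, Y, Z] : Fin 3 → Π x : M, Tan E x)
      ((0 : Fin 3).succAbove ((1 : Fin 2).succAbove l)) x) = ![Y x] := by
    funext j; fin_cases j; rfl
  have f11 : (fun l : Fin 1 => (![X, Y, Z] : Fin 3 → Π x : M, Tan E x)
      ((1 : Fin 3).succAbove ((1 : Fin 2).succAbove l)) x) = ![X x] := by
    funext j; fin_cases j; rfl
  have hX0 : (![X, Y, Z] : Fin 3 → Π x : M, Tan E x) 0 = X := rfl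
  have hX1 : (![X, Y, Z] : Fin 3 → Π x : M, Tan E x) 1 = Y := rfl
  have hX2 : (![X, Y, Z] : Fin 3 → Π x : M, Tan E x) 2 = Z := rfl
  have c1 : (1 : Fin 2).castSucc = 1 := rfl
  have c2 : (1 : Fin 2).succ = 2 := rfl
  rw [h]
  simp only [Nat.reduceAdd, Fin.sum_univ_three, Fin.sum_univ_two, hs0, hs1, Finset.sum_singleton,
    Finset.sum_pair (zero_ne_one (α := Fin 2)), c1, c2, f00, f01, f11, e0, e1, e2, hX0, hX1, hX2,
    Fin.isValue, Fin.val_zero, Fin.val_one, Fin.val_two, pow_zero, pow_one, zero_add,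
    Fin.castSucc_zero, Fin.succ_zero_eq_one, one_smul, neg_smul, even_two, Even.neg_pow, one_pow]
  ring

end

/-! ### Smoothness of the induced data -/

section

variable {E : Type*} [NormedAddCommGroup E] [NormedSpace ℝ E]
  {M : Type*} [TopologicalSpace M] [ChartedSpace E M] [IsManifold 𝓘(ℝ, E) ∞ M]

/-- The component `T* → T` of a bundle endomorphism of `T ⊕ T*`, in the trivializations at `x₀`. -/
def anchorBlock (A : Π x : M, GenTan E x →L[ℝ] GenTan E x) (x₀ x : M) : (E →L[ℝ] ℝ) →L[ℝ] E :=
  (ContinuousLinearMap.fst ℝ E (E →L[ℝ] ℝ)) ∘L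
    (ContinuousLinearMap.inCoordinates (GenModel E) (GenBundle E M) (GenModel E) (GenBundle E M)
      x₀ x x₀ x (A x)) ∘L (ContinuousLinearMap.inr ℝ E (E →L[ℝ] ℝ))

theorem IsSmoothEnd.contMDiffAt_anchorBlock {A : Π x : M, GenTan E x →L[ℝ] GenTan E x}
    (hA : IsSmoothEnd A) (x₀ : M) :
    ContMDiffAt 𝓘(ℝ, E) 𝓘(ℝ, (E →L[ℝ] ℝ) →L[ℝ] E) ∞ (anchorBlock A x₀) x₀ := by
  have h := ((contMDiffAt_hom_bundle _).1 (hA x₀)).2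
  exact contMDiffAt_const.clm_comp (h.clm_comp contMDiffAt_const)

theorem anchorBlock_apply (A : Π x : M, GenTan E x →L[ℝ] GenTan E x) {x₀ x : M}
    (hx : x ∈ (chartAt E x₀).source) (ξ : Cotan E x) :
    anchorBlock A x₀ x
      (trivializationAt (E →L[ℝ] ℝ) (fun y : M => Cotan E y) x₀ ⟨x, ξ⟩).2 =
      (trivializationAt E (TangentSpace 𝓘(ℝ, E)) x₀ ⟨x, (A x (0, ξ)).1⟩).2 := by
  -- The base set is that of T intersected with that of Hom(T, ℝ), and the latter is again the chart
  -- domain intersected with everything.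
  have hb : x ∈ (trivializationAt (GenModel E) (GenBundle E M) x₀).baseSet :=
    ⟨hx, hx, Set.mem_univ x⟩
  have h : (ContinuousLinearMap.inCoordinates (GenModel E) (GenBundle E M) (GenModel E)
      (GenBundle E M) x₀ x x₀ x (A x))
      (trivializationAt (GenModel E) (GenBundle E M) x₀ ⟨x, (0, ξ)⟩).2 =
      (trivializationAt (GenModel E) (GenBundle E M) x₀ ⟨x, A x (0, ξ)⟩).2 := by
    rw [ContinuousLinearMap.inCoordinates_eq hb hb]
    exact congrArg (fun w => (Bundle.Trivialization.continuousLinearEquivAt ℝ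
      (trivializationAt (GenModel E) (GenBundle E M) x₀) x hb) (A x w))
      ((Bundle.Trivialization.continuousLinearEquivAt ℝ
        (trivializationAt (GenModel E) (GenBundle E M) x₀) x hb).symm_apply_apply (0, ξ))
  have h0 : (trivializationAt (GenModel E) (GenBundle E M) x₀ ⟨x, (0, ξ)⟩).2 = 
    ((0 : E), (trivializationAt (E →L[ℝ] ℝ) (fun y : M => Cotan E y) x₀ ⟨x, ξ⟩).2) :=
    Prod.ext (map_zero (Bundle.Trivialization.continuousLinearEquivAt ℝ
      (trivializationAt E (TangentSpace 𝓘(ℝ, E)) x₀) x hx)) rfl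
  rw [h0] at h
  exact congrArg Prod.fst h

/-- T and T* have the same finite dimension, so injectivity of the block T* → T suffices. -/
theorem anchorBlock_isInvertible [FiniteDimensional ℝ E]
    {A : Π x : M, GenTan E x →L[ℝ] GenTan E x} {x₀ x : M}
    (hx : x ∈ (chartAt E x₀).source) (hinj : ∀ ξ : Cotan E x, (A x (0, ξ)).1 = 0 → ξ = 0) :
    (anchorBlock A x₀ x).IsInvertible := by
  let t := Bundle.Trivialization.continuousLinearEquivAt ℝ
    (trivializationAt E (TangentSpace 𝓘(ℝ, E)) x₀) x hx
  let t' := Bundle.Trivialization.continuousLinearEquivAt ℝ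
    (trivializationAt (E →L[ℝ] ℝ) (fun y : M => Cotan E y) x₀) x ⟨hx, Set.mem_univ x⟩
  have hker : LinearMap.ker (anchorBlock A x₀ x : (E →L[ℝ] ℝ) →ₗ[ℝ] E) = ⊥ := by
    refine LinearMap.ker_eq_bot'.2 fun ξ hξ => ?_
    have h1 := anchorBlock_apply A hx (t'.symm ξ)
    have h2 : anchorBlock A x₀ x ξ = t (A x (0, t'.symm ξ)).1 := by
      refine Eq.trans (congrArg _ (t'.apply_symm_apply ξ).symm) h1
    have h3 : t (A x (0, t'.symm ξ)).1 = 0 := h2.symm.trans hξ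
    have h4 := hinj _ (t.map_eq_zero_iff.1 h3)
    rw [← t'.apply_symm_apply ξ, h4, map_zero]
  have hdim : Module.finrank ℝ (E →L[ℝ] ℝ) = Module.finrank ℝ E := by
    rw [← Subspace.dual_finrank_eq (K := ℝ) (V := E)]
    exact (LinearMap.toContinuousLinearMap (𝕜 := ℝ) (E := E) (F' := ℝ)).finrank_eq.symm
  let e := (LinearEquiv.ofInjectiveOfFinrankEq (anchorBlock A x₀ x : (E →L[ℝ] ℝ) →ₗ[ℝ] E)
    (LinearMap.ker_eq_bot.1 hker) hdim).toContinuousLinearEquiv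
  exact ⟨e, by ext; rfl⟩

/-- In the trivializations ξ is the inverse block applied to a smooth field, and inversion of
operators is smooth. For 𝒢 the block is η⁻¹, so this yields smoothness of ηX although η is defined
only fibrewise. -/
theorem IsSmoothEnd.isSmoothCofield_of_fst [FiniteDimensional ℝ E]
    {A : Π x : M, GenTan E x →L[ℝ] GenTan E x} (hA : IsSmoothEnd A)
    (hinj : ∀ x (ξ : Cotan E x), (A x (0, ξ)).1 = 0 → ξ = 0) {ξ : Π x : M, Cotan E x}
    (hξ : IsSmoothField (fun x => (A x (0, ξ x)).1)) : IsSmoothCofield ξ := by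
  intro x₀
  rw [Bundle.contMDiffAt_section]
  have h1 := (Bundle.contMDiffAt_section x₀).1 (hξ x₀)
  have hinv := anchorBlock_isInvertible (mem_chart_source E x₀) (hinj x₀)
  have h2 : ContMDiffAt 𝓘(ℝ, E) 𝓘(ℝ, E →L[ℝ] (E →L[ℝ] ℝ)) ∞
      (fun x => (anchorBlock A x₀ x).inverse) x₀ :=
    (hinv.contDiffAt_map_inverse (n := ∞)).contMDiffAt.comp x₀ (hA.contMDiffAt_anchorBlock x₀)
  refine (h2.clm_apply h1).congr_of_eventuallyEq ?_
  filter_upwards [(chartAt E x₀).open_source.mem_nhds (mem_chart_source E x₀)] with x hx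
  rw [← anchorBlock_apply A hx]
  obtain ⟨e, he⟩ := anchorBlock_isInvertible hx (hinj x)
  rw [← he, ContinuousLinearMap.inverse_equiv]
  exact (e.symm_apply_apply _).symm

namespace GenAlmostParaKahler

variable (S : GenAlmostParaKahler E M)

/-- The vectors (0,ξ) ± 𝒢(0,ξ) are ±1-eigenvectors projecting to 0 in T, so both vanish by
nondegeneracy; their sum is (0, 2ξ). -/
theorem eq_zero_of_fst_G_eq_zero (x : M) (ξ : Cotan E x) (h : (S.G x (0, ξ)).1 = 0) : ξ = 0 := by
  have hp : (0, ξ) + S.G x (0, ξ) ∈ eigenbundle S.G 1 x := by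
    refine Module.End.mem_eigenspace_iff.mpr ?_
    refine (map_add (S.G x) _ _).trans ?_
    rw [S.metric.sq, one_smul, add_comm]
  have hm : (0, ξ) - S.G x (0, ξ) ∈ eigenbundle S.G (-1) x := by
    refine Module.End.mem_eigenspace_iff.mpr ?_
    refine (map_sub (S.G x) _ _).trans ?_
    rw [S.metric.sq, neg_smul, one_smul, neg_sub]
  have h1 : (⟨_, hp⟩ : eigenbundle S.G 1 x) = 0 := by
    refine (S.metric.nondegPlus x).1 ?_
    rw [map_zero]
    change ((0, ξ) + S.G x (0, ξ)).1 = 0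
    rw [Prod.fst_add, h, add_zero]
  have h2 : (⟨_, hm⟩ : eigenbundle S.G (-1) x) = 0 := by
    refine (S.metric.nondegMinus x).1 ?_
    rw [map_zero]
    change ((0, ξ) - S.G x (0, ξ)).1 = 0
    rw [Prod.fst_sub, h, sub_zero]
  have h3 := congrArg (fun w => w.1.2) h1
  have h4 := congrArg (fun w => w.1.2) h2
  simp only [Prod.snd_add, Prod.snd_sub, ZeroMemClass.coe_zero, Prod.snd_zero] at h3 h4
  have h5 : (2 : ℝ) • ξ = 0 := by
    rw [two_smul, ← add_zero (0 : Cotan E x)]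
    nth_rewrite 1 [← h3]
    rw [← h4]
    abel
  exact (smul_eq_zero.1 h5).resolve_left two_ne_zero

theorem G_piPlusInv_sub_piMinusInv (x : M) (X : Tan E x) :
    S.G x (S.piPlusInv x X - S.piMinusInv x X) = S.piPlusInv x X + S.piMinusInv x X := by
  refine ((S.G x).map_sub _ _).trans ?_
  rw [G_piPlusInv, G_piMinusInv, sub_neg_eq_add]

/-- The section is (0, 2ηX), and 𝒢 sends it to an element with tangent part 2X; inverting the T* → T
block of 𝒢 recovers it smoothly. Combining it with its image under 𝒢 then gives both lifts. -/
theorem isSmoothSection_piPlusInv_sub [FiniteDimensional ℝ E] {X : Π x : M, Tan E x}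
    (hX : IsSmoothField X) :
    IsSmoothSection (fun x => S.piPlusInv x (X x) - S.piMinusInv x (X x)) := by
  have h0 : ∀ x, (S.piPlusInv x (X x) - S.piMinusInv x (X x)).1 = 0 := fun x => by
    rw [Prod.fst_sub, fst_piPlusInv, fst_piMinusInv, sub_self]
  refine isSmoothSection_iff.2 ⟨?_, ?_⟩
  · simp only [h0]
    exact Bundle.contMDiff_zeroSection ℝ (fun y : M => Tan E y)
  · refine S.metric.smooth.isSmoothCofield_of_fst S.eq_zero_of_fst_G_eq_zero ?_
    have h1 : ∀ x, (S.G x (0, (S.piPlusInv x (X x) - S.piMinusInv x (X x)).2)).1 =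
        ((2 : ℝ) • X) x := fun x => by
      have : ((0, (S.piPlusInv x (X x) - S.piMinusInv x (X x)).2) : GenTan E x) =
        S.piPlusInv x (X x) - S.piMinusInv x (X x) := Prod.ext (h0 x).symm rfl
      rw [this, G_piPlusInv_sub_piMinusInv, Prod.fst_add, fst_piPlusInv,
        fst_piMinusInv]
      exact (two_smul ℝ (X x)).symm
    simp only [h1]
    exact hX.const_smul 2

theorem isSmoothSection_piPlusInv [FiniteDimensional ℝ E] {X : Π x : M, Tan E x}
    (hX : IsSmoothField X) : IsSmoothSection (fun x => S.piPlusInv x (X x)) := by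
  have h := S.isSmoothSection_piPlusInv_sub hX
  refine (congrArg IsSmoothSection (funext fun x => ?_)).mp
    ((h.add (S.metric.smooth.apply h)).const_smul (1 / 2))
  simp only [Pi.smul_apply, Pi.add_apply]
  rw [G_piPlusInv_sub_piMinusInv]
  module

theorem isSmoothSection_piMinusInv [FiniteDimensional ℝ E] {X : Π x : M, Tan E x}
    (hX : IsSmoothField X) : IsSmoothSection (fun x => S.piMinusInv x (X x)) := by
  have h := S.isSmoothSection_piPlusInv_sub hX
  refine (congrArg IsSmoothSection (funext fun x => ?_)).mp
    (((S.metric.smooth.apply h).sub h).const_smul (1 / 2))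
  simp only [Pi.smul_apply, Pi.sub_apply]
  rw [G_piPlusInv_sub_piMinusInv]
  module

end GenAlmostParaKahler

end

/-! ### The pairing and the Dorfman bracket -/

section

variable {E : Type*} [NormedAddCommGroup E] [NormedSpace ℝ E]
  {M : Type*} [TopologicalSpace M] [ChartedSpace E M]

section Pairing

variable {x : M}

theorem pairing_comm (u v : GenTan E x) : pairing u v = pairing v u :=
  add_comm _ _

theorem pairing_add_left (u u' v : GenTan E x) : pairing (u + u') v = pairing u v + pairing u' v := by
  simp only [pairing, Prod.fst_add, Prod.snd_add, _root_.add_apply, map_add]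
  ring

theorem pairing_smul_left (c : ℝ) (u v : GenTan E x) : pairing (c • u) v = c * pairing u v := by
  simp only [pairing, Prod.smul_fst, Prod.smul_snd, _root_.smul_apply, map_smul, smul_eq_mul]
  ring

theorem pairing_add_right (u v v' : GenTan E x) : pairing u (v + v') = pairing u v + pairing u v' := by
  rw [pairing_comm, pairing_add_left, pairing_comm v, pairing_comm v']

theorem pairing_smul_right (c : ℝ) (u v : GenTan E x) : pairing u (c • v) = c * pairing u v := by
  rw [pairing_comm, pairing_smul_left, pairing_comm]

theorem eq_zero_of_pairing_eq_zero [FiniteDimensional ℝ E] {u : GenTan E x}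
    (h : ∀ v, pairing u v = 0) : u = 0 := by
  have h2 : u.2 = 0 := by
    ext Y
    simpa [pairing] using h (Y, 0)
  have h1 : ∀ ξ : E →L[ℝ] ℝ, ξ u.1 = 0 := fun ξ => by
    have := h (0, ξ)
    rw [pairing, h2] at this
    exact (zero_add _).symm.trans this
  refine Prod.ext ?_ h2
  have h3 : ∀ w : E, (∀ ξ : E →L[ℝ] ℝ, ξ w = 0) → w = 0 := fun w hw =>
    SeparatingDual.eq_zero_of_forall_dual_eq_zero (R := ℝ) hw
  exact h3 _ h1

end Pairing

section Alternating

variable {V : Type*} [AddCommGroup V] [Module ℝ V] [TopologicalSpace V]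

theorem alt₃_swap (θ : V [⋀^Fin 3]→L[ℝ] ℝ) (X Y Z : V) : θ ![Y, X, Z] = -θ ![X, Y, Z] := by
  have h := θ.map_swap ![X, Y, Z] (i := 0) (j := 1) (by decide)
  refine Eq.trans (congrArg θ ?_) h
  funext i; fin_cases i <;> rfl

theorem alt₃_swap' (θ : V [⋀^Fin 3]→L[ℝ] ℝ) (X Y Z : V) : θ ![X, Z, Y] = -θ ![X, Y, Z] := by
  have h := θ.map_swap ![X, Y, Z] (i := 1) (j := 2) (by decide)
  refine Eq.trans (congrArg θ ?_) h
  funext i; fin_cases i <;> rfl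

theorem alt₃_cycle (θ : V [⋀^Fin 3]→L[ℝ] ℝ) (X Y Z : V) : θ ![Y, Z, X] = θ ![X, Y, Z] := by
  rw [alt₃_swap', alt₃_swap, neg_neg]

theorem alt₃_add (θ : V [⋀^Fin 3]→L[ℝ] ℝ) (X Y Z Z' : V) :
    θ ![X, Y, Z + Z'] = θ ![X, Y, Z] + θ ![X, Y, Z'] := by
  rw [← contract₃_apply, ← contract₃_apply, ← contract₃_apply, map_add]

theorem alt₃_smul (θ : V [⋀^Fin 3]→L[ℝ] ℝ) (c : ℝ) (X Y Z : V) :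
    θ ![X, Y, c • Z] = c * θ ![X, Y, Z] := by
  rw [← contract₃_apply, ← contract₃_apply, map_smul, smul_eq_mul]

end Alternating

theorem differential_neg (f : M → ℝ) (x : M) :
    differential (E := E) (fun y => -f y) x = -differential f x := by
  exact mfderiv_neg

theorem differential_const_mul {f : M → ℝ} (hf : ContMDiff 𝓘(ℝ, E) 𝓘(ℝ, ℝ) ∞ f) (c : ℝ) (x : M) :
    differential (E := E) (fun y => c * f y) x = c • differential f x :=
  const_smul_mfderiv (hf.mdifferentiableAt (by simp)) c

theorem differential_add {f g : M → ℝ} (hf : ContMDiff 𝓘(ℝ, E) 𝓘(ℝ, ℝ) ∞ f)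
    (hg : ContMDiff 𝓘(ℝ, E) 𝓘(ℝ, ℝ) ∞ g) (x : M) :
    differential (E := E) (fun y => f y + g y) x = differential f x + differential g x :=
  mfderiv_add (hf.mdifferentiableAt (by simp)) (hg.mdifferentiableAt (by simp))

variable [IsManifold 𝓘(ℝ, E) ∞ M] [FiniteDimensional ℝ E] [T2Space M]

/-- The term d(β(X)) of the Lie derivative cancels against a term of ι_X dβ, leaving only
derivatives of functions and Lie brackets of the tangent parts. -/
theorem pairing_dorfman (H : Π x : M, Tan E x [⋀^Fin 3]→L[ℝ] ℝ) {u v : Π x : M, GenTan E x}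
    (hu : IsSmoothSection u) (hv : IsSmoothSection v) {w : Π x : M, GenTan E x}
    (hw : IsSmoothSection w) (x : M) :
    pairing (dorfman H u v x) (w x) =
      differential (fun y => (v y).2 (w y).1) x (u x).1
      - (v x).2 (VectorField.mlieBracket 𝓘(ℝ, E) (fun y => (u y).1) (fun y => (w y).1) x)
      - differential (fun y => (u y).2 (w y).1) x (v x).1
      + differential (fun y => (u y).2 (v y).1) x (w x).1
      + (u x).2 (VectorField.mlieBracket 𝓘(ℝ, E) (fun y => (v y).1) (fun y => (w y).1) x)
      + (w x).2 (VectorField.mlieBracket 𝓘(ℝ, E) (fun y => (u y).1) (fun y => (v y).1) x)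
      + H x ![(u x).1, (v x).1, (w x).1] := by
  rw [isSmoothSection_iff] at hu hv hw
  simp only [pairing, dorfman, lieDerivCovector, _root_.add_apply, _root_.sub_apply,
    contract₂_apply, contract₃_apply]
  rw [extD_oneForm_apply_fields hv.2 hu.1 hw.1, extD_oneForm_apply_fields hu.2 hv.1 hw.1]
  ring

/-- Isotropy turns the derivatives of w(u) and v(u) into minus those of u(w) and u(v); the remaining
terms match by antisymmetry of the Lie bracket and of H. -/
theorem pairing_dorfman_cycle (H : Π x : M, Tan E x [⋀^Fin 3]→L[ℝ] ℝ) {u v w : Π x : M, GenTan E x}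
    (hu : IsSmoothSection u) (hv : IsSmoothSection v) (hw : IsSmoothSection w)
    (huv : ∀ x, pairing (u x) (v x) = 0) (huw : ∀ x, pairing (u x) (w x) = 0)
     (x : M) :
    pairing (dorfman H u v x) (w x) = pairing (dorfman H v w x) (u x) := by
  rw [pairing_dorfman H hu hv hw, pairing_dorfman H hv hw hu]
  have h1 : (fun y => (w y).2 (u y).1) = fun y => -((u y).2 (w y).1) :=
    funext fun y => by have := huw y; simp only [pairing] at this; linarith
  have h2 : (fun y => (v y).2 (u y).1) = fun y => -((u y).2 (v y).1) :=
    funext fun y => by have := huv y; simp only [pairing] at this; linarith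
  rw [h1, h2, differential_neg, differential_neg,
    VectorField.mlieBracket_swap_apply (V := fun y => (v y).1) (W := fun y => (u y).1),
    VectorField.mlieBracket_swap_apply (V := fun y => (w y).1) (W := fun y => (u y).1),
    alt₃_cycle (H x) (u x).1, map_neg, map_neg]
  simp only [_root_.neg_apply]
  ring

end

/-! ### The induced para-Hermitian structures -/

section

variable {E : Type*} [NormedAddCommGroup E] [NormedSpace ℝ E]
  {M : Type*} [TopologicalSpace M] [ChartedSpace E M] [IsManifold 𝓘(ℝ, E) ∞ M]

namespace GenAlmostParaKahler

variable (S : GenAlmostParaKahler E M)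

/-- The map `X ↦ X + (b + e η) X`, which is `π₊⁻¹` for `e = 1` and `π₋⁻¹` for `e = -1`. -/
def lift (e : ℝ) (x : M) : Tan E x →ₗ[ℝ] GenTan E x :=
  LinearMap.prod LinearMap.id (S.bMap x + e • S.eta x)

theorem lift_fst (e : ℝ) (x : M) (X : Tan E x) : (S.lift e x X).1 = X := rfl

theorem lift_snd (e : ℝ) (x : M) (X Y : Tan E x) :
    (S.lift e x X).2 Y = S.bMap x X Y + e * S.eta x X Y := rfl

theorem lift_one (x : M) : S.lift 1 x = S.piPlusInv x := by
  ext1 X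
  refine Prod.ext (S.fst_piPlusInv x X).symm ?_
  change S.bMap x X + (1 : ℝ) • S.eta x X = _
  simp only [bMap, eta, LinearMap.smul_apply, LinearMap.add_apply, LinearMap.sub_apply,
    LinearMap.comp_apply, LinearMap.snd_apply]
  module

theorem lift_neg_one (x : M) : S.lift (-1) x = S.piMinusInv x := by
  ext1 X
  refine Prod.ext (S.fst_piMinusInv x X).symm ?_
  change S.bMap x X + (-1 : ℝ) • S.eta x X = _
  simp only [bMap, eta, LinearMap.smul_apply, LinearMap.add_apply, LinearMap.sub_apply,
    LinearMap.comp_apply, LinearMap.snd_apply]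
  module

theorem bMap_swap (x : M) (X Y : Tan E x) : S.bMap x Y X = -S.bMap x X Y := by
  have h := S.bMap_self x (X + Y)
  simp only [map_add, _root_.add_apply, bMap_self] at h
  linarith

theorem eta_comm (x : M) (X Y : Tan E x) : S.eta x Y X = S.eta x X Y := by
  rw [eta_eq_plus, eta_eq_plus, pairing_comm]

theorem pairing_lift (e e' : ℝ) (x : M) (X Y : Tan E x) :
    pairing (S.lift e x X) (S.lift e' x Y) = (e + e') * S.eta x X Y := by
  simp only [pairing, lift_snd, lift_fst]
  rw [S.bMap_swap x X Y, S.eta_comm x X Y]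
  ring

variable [FiniteDimensional ℝ E]

theorem b_apply (x : M) (X Y : Tan E x) : S.b x ![X, Y] = S.bMap x X Y := rfl

theorem isSmoothSection_lift {e : ℝ} (he : e = 1 ∨ e = -1) {X : Π x : M, Tan E x}
    (hX : IsSmoothField X) : IsSmoothSection (fun x => S.lift e x (X x)) := by
  rcases he with rfl | rfl
  · simp only [lift_one]
    exact S.isSmoothSection_piPlusInv hX
  · simp only [lift_neg_one]
    exact S.isSmoothSection_piMinusInv hX

theorem contMDiff_eta {X Y : Π x : M, Tan E x} (hX : IsSmoothField X) (hY : IsSmoothField Y) :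
    ContMDiff 𝓘(ℝ, E) 𝓘(ℝ, ℝ) ∞ (fun x => S.eta x (X x) (Y x)) := by
  simp only [eta_eq_plus]
  exact contMDiff_const.mul
    ((S.isSmoothSection_piPlusInv hX).pairing (S.isSmoothSection_piPlusInv hY))

theorem contMDiff_bMap {X Y : Π x : M, Tan E x} (hX : IsSmoothField X) (hY : IsSmoothField Y) :
    ContMDiff 𝓘(ℝ, E) 𝓘(ℝ, ℝ) ∞ (fun x => S.bMap x (X x) (Y x)) := by
  have h1 := (isSmoothSection_iff.1 (S.isSmoothSection_lift (Or.inl rfl) hX)).2.apply hY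
  have h2 := h1.sub (S.contMDiff_eta hX hY)
  refine h2.congr fun x => ?_
  rw [lift_snd]
  ring

theorem isSmoothOnFields_b : IsSmoothOnFields S.b :=
  fun _ hX => S.contMDiff_bMap (hX 0) (hX 1)

/-- The para-Hermitian structure induced on `T` by the `e`-eigenbundle of the generalized metric:
an endomorphism `K` and its fundamental form `Ω = η K`. -/
structure IsHalf (e : ℝ) (K : Π x : M, Tan E x →L[ℝ] Tan E x)
    (Ω : Π x : M, Tan E x [⋀^Fin 2]→L[ℝ] ℝ) : Prop where
  sign : e = 1 ∨ e = -1
  lift_K : ∀ x X, S.lift e x (K x X) = S.KPlus x (S.lift e x X)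
  G_lift : ∀ x X, S.G x (S.lift e x X) = e • S.lift e x X
  omega_apply : ∀ x X Y, Ω x ![X, Y] = S.eta x (K x X) Y

theorem isHalf_plus : S.IsHalf 1 S.tanKPlus S.omegaPlus where
  sign := Or.inl rfl
  lift_K x X := by rw [lift_one, piPlusInv_tanKPlus]
  G_lift x X := by rw [lift_one, G_piPlusInv, one_smul]
  omega_apply _ _ _ := rfl

theorem isHalf_minus : S.IsHalf (-1) S.tanKMinus S.omegaMinus where
  sign := Or.inr rfl
  lift_K x X := by rw [lift_neg_one, piMinusInv_tanKMinus]
  G_lift x X := by rw [lift_neg_one, G_piMinusInv]; module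
  omega_apply _ _ _ := rfl

namespace IsHalf

variable {S} {e : ℝ} {K : Π x : M, Tan E x →L[ℝ] Tan E x} {Ω : Π x : M, Tan E x [⋀^Fin 2]→L[ℝ] ℝ}

theorem mul_self (h : S.IsHalf e K Ω) : e * e = 1 := by
  rcases h.sign with rfl | rfl <;> norm_num

theorem K_K (h : S.IsHalf e K Ω) (x : M) (X : Tan E x) : K x (K x X) = X := by
  have h1 : S.lift e x (K x (K x X)) = S.lift e x X := by
    rw [h.lift_K, h.lift_K, S.paraComplex.sq]
  exact congrArg Prod.fst h1

theorem eta_K_K (h : S.IsHalf e K Ω) (x : M) (X Y : Tan E x) :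
    S.eta x (K x X) (K x Y) = -S.eta x X Y := by
  have h1 := S.paraComplex.anti x (S.lift e x X) (S.lift e x Y)
  rw [← h.lift_K, ← h.lift_K, pairing_lift, pairing_lift] at h1
  rcases h.sign with rfl | rfl <;> linarith

theorem eta_K_left (h : S.IsHalf e K Ω) (x : M) (X Y : Tan E x) :
    S.eta x (K x X) Y = -S.eta x X (K x Y) := by
  rw [← h.eta_K_K, h.K_K]

theorem isSmoothField_K (h : S.IsHalf e K Ω) {X : Π x : M, Tan E x} (hX : IsSmoothField X) :
    IsSmoothField (fun x => K x (X x)) := by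
  have h1 := (isSmoothSection_iff.1
    (S.paraComplex.smooth.apply (S.isSmoothSection_lift h.sign hX))).1
  simp only [← h.lift_K] at h1
  exact h1

theorem isSmoothOnFields_omega (h : S.IsHalf e K Ω) : IsSmoothOnFields Ω := fun X hX => by
  have h1 : ∀ x, Ω x (fun i => X i x) = S.eta x (K x (X 0 x)) (X 1 x) := fun x => by
    rw [← h.omega_apply]
    congr 1
    funext i; fin_cases i <;> rfl
  simp only [h1]
  exact S.contMDiff_eta (h.isSmoothField_K (hX 0)) (hX 1)

theorem eta_eq_zero (h : S.IsHalf e K Ω) {x : M} {s : ℝ} (hs : s * s = 1)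
    {X Y : Tan E x} (hX : K x X = s • X) (hY : K x Y = s • Y) : S.eta x X Y = 0 := by
  have h1 := h.eta_K_K x X Y
  rw [hX, hY] at h1
  simp only [map_smul, _root_.smul_apply, smul_eq_mul] at h1
  rw [← mul_assoc, hs] at h1
  linarith

end IsHalf

/-- The contributions of b assemble into db; those of η do not form a tensor by themselves, which is
why the next step restricts to eigenfields of K. -/
theorem pairing_dorfman_lift [T2Space M] (H : Π x : M, Tan E x [⋀^Fin 3]→L[ℝ] ℝ) {e e' : ℝ}
    (he : e = 1 ∨ e = -1) (he' : e' = 1 ∨ e' = -1)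
    {X Y Z : Π x : M, Tan E x} (hX : IsSmoothField X) (hY : IsSmoothField Y)
    (hZ : IsSmoothField Z) (x : M) :
    pairing (dorfman H (fun y => S.lift e y (X y)) (fun y => S.lift e y (Y y)) x)
        (S.lift e' x (Z x)) =
      H x ![X x, Y x, Z x] + extD S.b x ![X x, Y x, Z x] +
      e * (differential (fun y => S.eta y (Y y) (Z y)) x (X x)
        - S.eta x (Y x) (VectorField.mlieBracket 𝓘(ℝ, E) X Z x)
        - differential (fun y => S.eta y (X y) (Z y)) x (Y x)
        + differential (fun y => S.eta y (X y) (Y y)) x (Z x)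
        + S.eta x (X x) (VectorField.mlieBracket 𝓘(ℝ, E) Y Z x))
      + e' * S.eta x (Z x) (VectorField.mlieBracket 𝓘(ℝ, E) X Y x) := by
  rw [pairing_dorfman H (S.isSmoothSection_lift he hX) (S.isSmoothSection_lift he hY)
    (w := fun y => S.lift e' y (Z y)) (S.isSmoothSection_lift he' hZ),
    extD_twoForm_apply_fields S.isSmoothOnFields_b hX hY hZ]
  have key : ∀ {A B : Π x : M, Tan E x}, IsSmoothField A → IsSmoothField B →
      differential (E := E) (fun y => S.bMap y (A y) (B y) + e * S.eta y (A y) (B y)) x =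
        differential (fun y => S.bMap y (A y) (B y)) x
          + e • differential (fun y => S.eta y (A y) (B y)) x := fun hA hB => by
    rw [differential_add (S.contMDiff_bMap hA hB)
        (show ContMDiff 𝓘(ℝ, E) 𝓘(ℝ, ℝ) ∞ fun y => e * S.eta y _ _ from
          contMDiff_const.mul (S.contMDiff_eta hA hB)),
      differential_const_mul (S.contMDiff_eta hA hB)]
  simp only [lift_fst, lift_snd, b_apply]
  rw [key hY hZ, key hX hZ, key hX hY, S.bMap_swap x (Y x), S.bMap_swap x (X x),
    S.bMap_swap x (Z x)]
  simp only [_root_.add_apply, _root_.smul_apply, smul_eq_mul]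
  ring

variable {S} in
-- On the s-eigenbundle ω(X,·) = sη(X,·), so the η-terms are those of es dω, up to the sign of
-- η([X,Y],Z). That discrepancy produces the coefficient e + e'.
theorem IsHalf.pairing_dorfman_lift [T2Space M] (H : Π x : M, Tan E x [⋀^Fin 3]→L[ℝ] ℝ)
    {e e' s : ℝ} {K : Π x : M, Tan E x →L[ℝ] Tan E x} {Ω : Π x : M, Tan E x [⋀^Fin 2]→L[ℝ] ℝ}
    (h : S.IsHalf e K Ω) (he' : e' = 1 ∨ e' = -1) (hs : s * s = 1)
    {X Y Z : Π x : M, Tan E x} (hX : IsSmoothField X) (hY : IsSmoothField Y)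
    (hZ : IsSmoothField Z) (hKX : ∀ x, K x (X x) = s • X x) (hKY : ∀ x, K x (Y x) = s • Y x)
    (x : M) (hK : K x (VectorField.mlieBracket 𝓘(ℝ, E) X Y x) =
      s • VectorField.mlieBracket 𝓘(ℝ, E) X Y x) :
    pairing (dorfman H (fun y => S.lift e y (X y)) (fun y => S.lift e y (Y y)) x)
        (S.lift e' x (Z x)) =
      H x ![X x, Y x, Z x] + extD S.b x ![X x, Y x, Z x] + e * s * extD Ω x ![X x, Y x, Z x]
      + (e + e') * S.eta x (VectorField.mlieBracket 𝓘(ℝ, E) X Y x) (Z x) := by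
  rw [S.pairing_dorfman_lift H h.sign he' hX hY hZ,
    extD_twoForm_apply_fields h.isSmoothOnFields_omega hX hY hZ]
  -- Nothing is known about K[X,Z] or K[Y,Z]; skewness of ηK moves K onto the other argument, which
  -- is an eigenvector.
  have hswap : ∀ (A B : Tan E x), K x B = s • B → S.eta x (K x A) B = -s * S.eta x B A :=
    fun A B hB => by
      rw [h.eta_K_left, hB, map_smul, smul_eq_mul, S.eta_comm x B A, neg_mul]
  simp only [h.omega_apply, hKX, hKY, hK, hswap _ _ (hKX x), hswap _ _ (hKY x), map_smul,
    _root_.smul_apply, smul_eq_mul]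
  rw [differential_const_mul (S.contMDiff_eta hY hZ), differential_const_mul (S.contMDiff_eta hX hZ),
    differential_const_mul (S.contMDiff_eta hX hY)]
  simp only [_root_.smul_apply, smul_eq_mul]
  linear_combination (-e * (differential (fun y => S.eta y (Y y) (Z y)) x (X x)
        - S.eta x (Y x) (VectorField.mlieBracket 𝓘(ℝ, E) X Z x)
        - differential (fun y => S.eta y (X y) (Z y)) x (Y x)
        + differential (fun y => S.eta y (X y) (Y y)) x (Z x)
        + S.eta x (X x) (VectorField.mlieBracket 𝓘(ℝ, E) Y Z x)
        - S.eta x (VectorField.mlieBracket 𝓘(ℝ, E) X Y x) (Z x))) * hs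
    - e' * S.eta_comm x (Z x) (VectorField.mlieBracket 𝓘(ℝ, E) X Y x)

end GenAlmostParaKahler

end

/-! ### Involutivity of eigenbundles -/

section

variable {E : Type*} [NormedAddCommGroup E] [NormedSpace ℝ E]
  {M : Type*} [TopologicalSpace M] [ChartedSpace E M] [IsManifold 𝓘(ℝ, E) ∞ M]

theorem mem_eigenbundle {A : Π x : M, GenTan E x →L[ℝ] GenTan E x} {s : ℝ} {x : M}
    {u : GenTan E x} : u ∈ eigenbundle A s x ↔ A x u = s • u :=
  Module.End.mem_eigenspace_iff

/-- An eigenbundle of an anti-orthogonal involution is its own annihilator. -/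
theorem mem_eigenbundle_of_pairing_eq_zero [FiniteDimensional ℝ E]
    {A : Π x : M, GenTan E x →L[ℝ] GenTan E x} {x : M} (hsq : ∀ u, A x (A x u) = u)
    (hanti : ∀ u v, pairing (A x u) (A x v) = -pairing u v) {a : ℝ} (ha : a * a = 1)
    {w : GenTan E x} (hw : ∀ v ∈ eigenbundle A a x, pairing w v = 0) :
    w ∈ eigenbundle A a x := by
  have h0 : w + (-a) • A x w = 0 := by
    refine eq_zero_of_pairing_eq_zero fun v => ?_
    -- Since A² = 1 and a² = 1, v + aAv is an arbitrary vector projected, up to a factor 2, to the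
    -- a-eigenspace. Anti-orthogonality then moves A from v to w, giving ⟨w - aAw, v⟩ = 0.
    have hv : v + a • A x v ∈ eigenbundle A a x := by
      rw [mem_eigenbundle]
      refine ((A x).map_add _ _).trans ?_
      rw [(A x).map_smul, hsq, smul_add, smul_smul, ha, one_smul, add_comm]
    have h1 := hw _ hv
    have h2 := hanti w (A x v)
    rw [hsq] at h2
    rw [pairing_add_right, pairing_smul_right] at h1
    rw [pairing_add_left, pairing_smul_left, h2]
    linarith
  rw [mem_eigenbundle]
  have h1 : w = a • A x w := by
    have h2 : w - a • A x w = w + (-a) • A x w := by module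
    exact sub_eq_zero.1 (h2.trans h0)
  conv_rhs => rw [h1]
  rw [smul_smul, ha, one_smul]

namespace GenAlmostParaKahler

variable (S : GenAlmostParaKahler E M)

theorem KMinus_apply (x : M) (u : GenTan E x) : S.KMinus x u = S.G x (S.KPlus x u) := rfl

theorem KMinus_KMinus (x : M) (u : GenTan E x) : S.KMinus x (S.KMinus x u) = u := by
  rw [KMinus_apply, KMinus_apply, S.comm, S.metric.sq, S.paraComplex.sq]

theorem pairing_KMinus (x : M) (u v : GenTan E x) :
    pairing (S.KMinus x u) (S.KMinus x v) = -pairing u v := by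
  rw [KMinus_apply, KMinus_apply, S.metric.orth, S.paraComplex.anti]

variable {S}

theorem eq_lift_of_G_eq {e : ℝ} (he : e = 1 ∨ e = -1) {x : M} {w : GenTan E x}
    (hw : S.G x w = e • w) : w = S.lift e x w.1 := by
  rcases he with rfl | rfl
  · have h1 : S.lift 1 x w.1 ∈ eigenbundle S.G 1 x := by
      rw [mem_eigenbundle, lift_one, G_piPlusInv, one_smul]
    exact congrArg Subtype.val
      ((S.metric.nondegPlus x).1 (a₁ := ⟨w, mem_eigenbundle.2 hw⟩) (a₂ := ⟨_, h1⟩) rfl)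
  · have h1 : S.lift (-1) x w.1 ∈ eigenbundle S.G (-1) x := by
      rw [mem_eigenbundle, lift_neg_one, G_piMinusInv]
      module
    exact congrArg Subtype.val
      ((S.metric.nondegMinus x).1 (a₁ := ⟨w, mem_eigenbundle.2 hw⟩) (a₂ := ⟨_, h1⟩) rfl)

theorem eq_lift_add_lift (x : M) (u : GenTan E x) :
    u = S.lift 1 x ((1 / 2 : ℝ) • (u + S.G x u)).1 +
      S.lift (-1) x ((1 / 2 : ℝ) • (u - S.G x u)).1 := by
  rw [← eq_lift_of_G_eq (S := S) (Or.inl rfl) (w := (1 / 2 : ℝ) • (u + S.G x u)),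
    ← eq_lift_of_G_eq (S := S) (Or.inr rfl) (w := (1 / 2 : ℝ) • (u - S.G x u))]
  · module
  · rw [(S.G x).map_smul, (S.G x).map_sub, S.metric.sq]
    module
  · rw [(S.G x).map_smul, (S.G x).map_add, S.metric.sq]
    module

theorem exists_eq_lift_add_lift [FiniteDimensional ℝ E] {u : Π x : M, GenTan E x}
    (hu : IsSmoothSection u) :
    ∃ X Y : Π x : M, Tan E x, IsSmoothField X ∧ IsSmoothField Y ∧
      ∀ x, u x = S.lift 1 x (X x) + S.lift (-1) x (Y x) := by
  have hG := S.metric.smooth.apply hu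
  exact ⟨_, _, (isSmoothSection_iff.1 ((hu.add hG).const_smul (1 / 2))).1,
    (isSmoothSection_iff.1 ((hu.sub hG).const_smul (1 / 2))).1, fun x => eq_lift_add_lift x (u x)⟩

/-- The projector (1 + sK)/2 keeps any smooth extension of v inside the eigenbundle and fixes v. -/
theorem IsHalf.exists_field [FiniteDimensional ℝ E] [T2Space M] {e : ℝ}
    {K : Π x : M, Tan E x →L[ℝ] Tan E x} {Ω : Π x : M, Tan E x [⋀^Fin 2]→L[ℝ] ℝ}
    (h : S.IsHalf e K Ω) {s : ℝ} (hs : s * s = 1) {x : M} {v : Tan E x} (hv : K x v = s • v) :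
    ∃ X : Π x : M, Tan E x, IsSmoothField X ∧ (∀ y, K y (X y) = s • X y) ∧ X x = v := by
  obtain ⟨Y, hY, hYx⟩ := exists_isSmoothField_eq x v
  refine ⟨_, (hY.add ((h.isSmoothField_K hY).const_smul s)).const_smul (1 / 2), fun y => ?_, ?_⟩
  · simp only [Pi.smul_apply, Pi.add_apply]
    rw [map_smul, map_add, map_smul, h.K_K]
    have : (1 : ℝ) = s * s := hs.symm
    match_scalars <;> linarith
  · simp only [Pi.smul_apply, Pi.add_apply]
    rw [hYx, hv, smul_smul, hs]
    module

/-- The condition on the eigenbundle `T_s` of `K` equivalent to involutivity of its lift. -/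
def IsGood [FiniteDimensional ℝ E] (S : GenAlmostParaKahler E M)
    (H : Π x : M, Tan E x [⋀^Fin 3]→L[ℝ] ℝ) (e : ℝ)
    (K : Π x : M, Tan E x →L[ℝ] Tan E x) (Ω : Π x : M, Tan E x [⋀^Fin 2]→L[ℝ] ℝ) (s : ℝ) : Prop :=
  ∀ X Y : Π x : M, Tan E x, IsSmoothField X → IsSmoothField Y →
    (∀ x, K x (X x) = s • X x) → (∀ x, K x (Y x) = s • Y x) → ∀ x,
      K x (VectorField.mlieBracket 𝓘(ℝ, E) X Y x) = s • VectorField.mlieBracket 𝓘(ℝ, E) X Y x ∧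
      ∀ z, H x ![X x, Y x, z] + extD S.b x ![X x, Y x, z] + e * s * extD Ω x ![X x, Y x, z] = 0

variable [FiniteDimensional ℝ E] [T2Space M] {H : Π x : M, Tan E x [⋀^Fin 3]→L[ℝ] ℝ}

/-- The lift of the s-eigenbundle lies in eigenbundles of both 𝒦_+ and 𝒦_-, hence so does the
bracket w of two lifts. Therefore w is an e-eigenvector of 𝒢, so w = lift e [X,Y]. -/
theorem IsHalf.isGood_of_isIntegrable {e : ℝ}
    {K : Π x : M, Tan E x →L[ℝ] Tan E x} {Ω : Π x : M, Tan E x [⋀^Fin 2]→L[ℝ] ℝ}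
    (h : S.IsHalf e K Ω) (hint : S.IsIntegrable H) {s : ℝ} (hs : s = 1 ∨ s = -1) :
    S.IsGood H e K Ω s := by
  intro X Y hX hY hKX hKY x
  have hss : s * s = 1 := by rcases hs with rfl | rfl <;> norm_num
  have hP : IsInvolutive H (eigenbundle S.KPlus s) := by
    rcases hs with rfl | rfl
    · exact hint.1.1
    · exact hint.1.2
  have hM : IsInvolutive H (eigenbundle S.KMinus (e * s)) := by
    rcases h.sign with rfl | rfl <;> rcases hs with rfl | rfl
    · rw [one_mul]; exact hint.2.1
    · rw [one_mul]; exact hint.2.2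
    · rw [mul_one]; exact hint.2.2
    · rw [neg_mul_neg, one_mul]; exact hint.2.1
  have memP : ∀ {Z : Π x : M, Tan E x}, (∀ x, K x (Z x) = s • Z x) → ∀ y,
      S.lift e y (Z y) ∈ eigenbundle S.KPlus s y := fun hZ y => by
    rw [mem_eigenbundle, ← h.lift_K, hZ, map_smul]
  have memM : ∀ {Z : Π x : M, Tan E x}, (∀ x, K x (Z x) = s • Z x) → ∀ y,
      S.lift e y (Z y) ∈ eigenbundle S.KMinus (e * s) y := fun hZ y => by
    rw [mem_eigenbundle, KMinus_apply, ← h.lift_K, h.G_lift, hZ, map_smul, smul_smul]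
  have hsX := S.isSmoothSection_lift h.sign hX
  have hsY := S.isSmoothSection_lift h.sign hY
  have h1 := mem_eigenbundle.1 (hP _ _ hsX hsY (memP hKX) (memP hKY) x)
  have h2 := mem_eigenbundle.1 (hM _ _ hsX hsY (memM hKX) (memM hKY) x)
  set w := dorfman H (fun y => S.lift e y (X y)) (fun y => S.lift e y (Y y)) x with hw
  rw [KMinus_apply, h1, (S.G x).map_smul] at h2
  have h3 : S.G x w = e • w := by
    have := congrArg (fun z => s • z) h2
    simp only [smul_smul] at this
    rw [hss, one_smul, mul_left_comm, hss, mul_one] at this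
    exact this
  have h4 := eq_lift_of_G_eq h.sign h3
  have hbr : VectorField.mlieBracket 𝓘(ℝ, E) X Y x = w.1 := rfl
  have hK : K x (VectorField.mlieBracket 𝓘(ℝ, E) X Y x) =
      s • VectorField.mlieBracket 𝓘(ℝ, E) X Y x := by
    have h5 := h.lift_K x w.1
    rw [← h4, h1] at h5
    exact congrArg Prod.fst h5
  refine ⟨hK, fun z => ?_⟩
  obtain ⟨Z, hZ, rfl⟩ := exists_isSmoothField_eq x z
  have h6 := h.pairing_dorfman_lift H h.sign hss hX hY hZ hKX hKY x hK
  -- Pairing lift e [X,Y] directly with lift e Z gives 2eη([X,Y],Z), which is exactly the last term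
  -- of the general formula; the three-form part must vanish.
  rw [← hw, h4, pairing_lift, ← hbr] at h6
  linarith

/-- Sections `lift e X` with `K X = s X`. -/
def IsLiftOf (S : GenAlmostParaKahler E M) (e : ℝ) (K : Π x : M, Tan E x →L[ℝ] Tan E x) (s : ℝ)
    (u : Π x : M, GenTan E x) : Prop :=
  ∃ X, IsSmoothField X ∧ (∀ x, K x (X x) = s • X x) ∧ u = fun x => S.lift e x (X x)

/-- The three-form part vanishes by `IsGood`. The η-term vanishes because the eigenbundle is
η-isotropic when w is in the same summand, and because e + e' = 0 when w is in the opposite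
𝒢-eigenbundle. -/
theorem IsHalf.pairing_dorfman_eq_zero {e e' s : ℝ}
    {K K' : Π x : M, Tan E x →L[ℝ] Tan E x} {Ω : Π x : M, Tan E x [⋀^Fin 2]→L[ℝ] ℝ}
    (h : S.IsHalf e K Ω) (hs : s * s = 1) (hgood : S.IsGood H e K Ω s) {u v w : Π x : M, GenTan E x}
    (hu : S.IsLiftOf e K s u) (hv : S.IsLiftOf e K s v)
    (hw : S.IsLiftOf e K s w ∨ e' = -e ∧ ∃ s', S.IsLiftOf e' K' s' w) (x : M) :
    pairing (dorfman H u v x) (w x) = 0 := by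
  obtain ⟨X, hX, hKX, rfl⟩ := hu
  obtain ⟨Y, hY, hKY, rfl⟩ := hv
  obtain ⟨h1, h2⟩ := hgood X Y hX hY hKX hKY x
  rcases hw with ⟨Z, hZ, hKZ, rfl⟩ | ⟨rfl, s', Z, hZ, hKZ, rfl⟩
  · rw [h.pairing_dorfman_lift H h.sign hs hX hY hZ hKX hKY x h1, h2,
      h.eta_eq_zero hs h1 (hKZ x), mul_zero, add_zero]
  · have he' : -e = 1 ∨ -e = -1 := by rcases h.sign with rfl | rfl <;> simp
    rw [h.pairing_dorfman_lift H he' hs hX hY hZ hKX hKY x h1, h2, add_neg_cancel, zero_mul,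
      add_zero]

/-- Serves both structures: t = s for 𝒦_+, and t = -s for 𝒦_- because 𝒢 contributes a sign on its
-1-eigenbundle. -/
theorem isInvolutive_of_isGood {K₁ K₂ : Π x : M, Tan E x →L[ℝ] Tan E x}
    {Ω₁ Ω₂ : Π x : M, Tan E x [⋀^Fin 2]→L[ℝ] ℝ} (h₁ : S.IsHalf 1 K₁ Ω₁) (h₂ : S.IsHalf (-1) K₂ Ω₂)
    {s t : ℝ} (hs : s * s = 1) (ht : t * t = 1) (hg₁ : S.IsGood H 1 K₁ Ω₁ s)
    (hg₂ : S.IsGood H (-1) K₂ Ω₂ t) {A : Π x : M, GenTan E x →L[ℝ] GenTan E x} {a : ℝ}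
    (hsq : ∀ x u, A x (A x u) = u) (hanti : ∀ x u v, pairing (A x u) (A x v) = -pairing u v)
    (ha : a * a = 1)
    (hmem : ∀ x X Y, S.lift 1 x X + S.lift (-1) x Y ∈ eigenbundle A a x →
      K₁ x X = s • X ∧ K₂ x Y = t • Y) :
    IsInvolutive H (eigenbundle A a) := by
  intro u v hu hv hLu hLv x
  let P : (Π x : M, GenTan E x) → Prop := fun u => S.IsLiftOf 1 K₁ s u ∨ S.IsLiftOf (-1) K₂ t u
  have smoothP : ∀ {c}, P c → IsSmoothSection c := by
    rintro c (⟨X, hX, -, rfl⟩ | ⟨X, hX, -, rfl⟩)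
    · exact S.isSmoothSection_lift (Or.inl rfl) hX
    · exact S.isSmoothSection_lift (Or.inr rfl) hX
  have isoP : ∀ {c d}, P c → P d → ∀ y, pairing (c y) (d y) = 0 := by
    rintro c d (⟨X, hX, hKX, rfl⟩ | ⟨X, hX, hKX, rfl⟩) (⟨Y, hY, hKY, rfl⟩ | ⟨Y, hY, hKY, rfl⟩) y
    · rw [pairing_lift, h₁.eta_eq_zero hs (hKX y) (hKY y), mul_zero]
    · rw [pairing_lift, add_neg_cancel, zero_mul]
    · rw [pairing_lift, neg_add_cancel, zero_mul]
    · rw [pairing_lift, h₂.eta_eq_zero ht (hKX y) (hKY y), mul_zero]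
  have cycP : ∀ {c d f}, P c → P d → P f → pairing (dorfman H c d x) (f x) =
      pairing (dorfman H d f x) (c x) := fun hu hv hw =>
    pairing_dorfman_cycle H (smoothP hu) (smoothP hv) (smoothP hw) (isoP hu hv) (isoP hu hw) x
  -- Two of the three sections belong to the same summand; cyclic rotation brings them into the
  -- bracket.
  have zeroP : ∀ {c d f}, P c → P d → P f → pairing (dorfman H c d x) (f x) = 0 := by
    have main₁ : ∀ {c d f}, S.IsLiftOf 1 K₁ s c → S.IsLiftOf 1 K₁ s d → P f →
        pairing (dorfman H c d x) (f x) = 0 := fun hu hv hw =>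
      h₁.pairing_dorfman_eq_zero (e' := -1) (K' := K₂) hs hg₁ hu hv
        (hw.imp id fun hw => ⟨rfl, t, hw⟩) x
    have main₂ : ∀ {c d f}, S.IsLiftOf (-1) K₂ t c → S.IsLiftOf (-1) K₂ t d → P f →
        pairing (dorfman H c d x) (f x) = 0 := fun hu hv hw =>
      h₂.pairing_dorfman_eq_zero (e' := 1) (K' := K₁) ht hg₂ hu hv
        (hw.symm.imp id fun hw => ⟨(neg_neg 1).symm, s, hw⟩) x
    intro c d f hc hd hf
    rcases hc with hc' | hc' <;> rcases hd with hd' | hd'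
    · exact main₁ hc' hd' hf
    · rcases hf with hf' | hf'
      · rw [cycP (.inl hc') (.inr hd') (.inl hf'), cycP (.inr hd') (.inl hf') (.inl hc')]
        exact main₁ hf' hc' (.inr hd')
      · rw [cycP (.inl hc') (.inr hd') (.inr hf')]
        exact main₂ hd' hf' (.inl hc')
    · rcases hf with hf' | hf'
      · rw [cycP (.inr hc') (.inl hd') (.inl hf')]
        exact main₁ hd' hf' (.inr hc')
      · rw [cycP (.inr hc') (.inl hd') (.inr hf'), cycP (.inl hd') (.inr hf') (.inr hc')]
        exact main₂ hf' hc' (.inl hd')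
    · exact main₂ hc' hd' hf
  have decomp : ∀ {c}, IsSmoothSection c → (∀ x, c x ∈ eigenbundle A a x) →
      ∃ c₁ c₂, P c₁ ∧ P c₂ ∧ c = c₁ + c₂ := by
    intro c hc hLc
    obtain ⟨X, Y, hX, hY, hXY⟩ := exists_eq_lift_add_lift (S := S) hc
    have hK := fun y => hmem y (X y) (Y y) (hXY y ▸ hLc y)
    exact ⟨_, _, Or.inl ⟨X, hX, fun y => (hK y).1, rfl⟩, Or.inr ⟨Y, hY, fun y => (hK y).2, rfl⟩,
      funext hXY⟩
  refine mem_eigenbundle_of_pairing_eq_zero (hsq x) (hanti x) ha fun w₀ hw₀ => ?_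
  -- The test vector lives at x only, but cyclic rotation needs sections, so its two components are
  -- extended within their eigenbundles.
  obtain ⟨w₁, w₂, hw₁, hw₂, hw₁₂⟩ : ∃ w₁ w₂, P w₁ ∧ P w₂ ∧ w₀ = w₁ x + w₂ x := by
    obtain ⟨h3, h4⟩ := hmem x _ _ (eq_lift_add_lift (S := S) x w₀ ▸ hw₀)
    obtain ⟨X, hX, hKX, hXx⟩ := h₁.exists_field hs h3
    obtain ⟨Y, hY, hKY, hYx⟩ := h₂.exists_field ht h4
    refine ⟨_, _, Or.inl ⟨X, hX, hKX, rfl⟩, Or.inr ⟨Y, hY, hKY, rfl⟩, ?_⟩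
    rw [hXx, hYx]
    exact eq_lift_add_lift x w₀
  obtain ⟨u₁, u₂, hu₁, hu₂, rfl⟩ := decomp hu hLu
  obtain ⟨v₁, v₂, hv₁, hv₂, rfl⟩ := decomp hv hLv
  have huv : ∀ y, pairing ((u₁ + u₂) y) ((v₁ + v₂) y) = 0 := fun y => by
    simp only [Pi.add_apply, pairing_add_left, pairing_add_right, isoP hu₁ hv₁, isoP hu₁ hv₂,
      isoP hu₂ hv₁, isoP hu₂ hv₂, add_zero]
  -- Additivity of the bracket is never needed: each rotation carries a sum out of the bracket into
  -- the second slot of the pairing, where linearity is pointwise.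
  have step : ∀ {w}, P w → pairing (dorfman H (u₁ + u₂) (v₁ + v₂) x) (w x) = 0 := by
    intro w hw
    have step' : ∀ {c}, P c → pairing (dorfman H (v₁ + v₂) w x) (c x) = 0 := by
      intro c hc
      rw [pairing_dorfman_cycle H ((smoothP hv₁).add (smoothP hv₂)) (smoothP hw) (smoothP hc)]
      · rw [Pi.add_apply, pairing_add_right, zeroP hw hc hv₁, zeroP hw hc hv₂, add_zero]
      · intro y
        rw [Pi.add_apply, pairing_add_left, isoP hv₁ hw, isoP hv₂ hw, add_zero]
      · intro y
        rw [Pi.add_apply, pairing_add_left, isoP hv₁ hc, isoP hv₂ hc, add_zero]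
    rw [pairing_dorfman_cycle H ((smoothP hu₁).add (smoothP hu₂))
      ((smoothP hv₁).add (smoothP hv₂)) (smoothP hw) huv]
    · rw [Pi.add_apply, pairing_add_right, step' hu₁, step' hu₂, add_zero]
    · intro y
      rw [Pi.add_apply, pairing_add_left, isoP hu₁ hw, isoP hu₂ hw, add_zero]
  rw [hw₁₂, pairing_add_right, step hw₁, step hw₂, add_zero]

end GenAlmostParaKahler

end

/-! ### Integrability -/

section

variable {E : Type*} [NormedAddCommGroup E] [NormedSpace ℝ E]
  {M : Type*} [TopologicalSpace M] [ChartedSpace E M] [IsManifold 𝓘(ℝ, E) ∞ M]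

/-! ### Eigenspace decompositions, three-forms and the Nijenhuis tensor -/

theorem exists_eigen_add_eigen {x : M} {K : Tan E x →L[ℝ] Tan E x} (hK : ∀ X, K (K X) = X) {s : ℝ}
    (hs : s * s = 1) (X : Tan E x) : ∃ Y Z, K Y = s • Y ∧ K Z = (-s) • Z ∧ X = Y + Z := by
  refine ⟨(1 / 2 : ℝ) • (X + s • K X), (1 / 2 : ℝ) • (X + (-s) • K X), ?_, ?_, by module⟩ <;>
  · rw [map_smul, map_add, map_smul, hK]
    match_scalars <;> linarith

theorem alt₃_add_left {V : Type*} [AddCommGroup V] [Module ℝ V] [TopologicalSpace V]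
    (θ : V [⋀^Fin 3]→L[ℝ] ℝ) (X X' Y Z : V) :
    θ ![X + X', Y, Z] = θ ![X, Y, Z] + θ ![X', Y, Z] := by
  rw [← alt₃_cycle, alt₃_add, alt₃_cycle θ X, alt₃_cycle θ X']

theorem alt₃_add_mid {V : Type*} [AddCommGroup V] [Module ℝ V] [TopologicalSpace V]
    (θ : V [⋀^Fin 3]→L[ℝ] ℝ) (X Y Y' Z : V) :
    θ ![X, Y + Y', Z] = θ ![X, Y, Z] + θ ![X, Y', Z] := by
  rw [alt₃_swap', alt₃_add, alt₃_swap' θ X Y Z, alt₃_swap' θ X Y' Z]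
  ring

/-- A three-form vanishes if it vanishes on triples of eigenvectors of a product structure whose
first two entries have the same eigenvalue. -/
theorem alt₃_eq_zero_of_eigen {x : M} {K : Tan E x →L[ℝ] Tan E x} (hK : ∀ X, K (K X) = X)
    (θ : Tan E x [⋀^Fin 3]→L[ℝ] ℝ)
    (h : ∀ s t : ℝ, (s = 1 ∨ s = -1) → (t = 1 ∨ t = -1) → ∀ X Y Z, K X = s • X → K Y = s • Y →
      K Z = t • Z → θ ![X, Y, Z] = 0) (X Y Z : Tan E x) : θ ![X, Y, Z] = 0 := by
  have h1 : (1 : ℝ) = 1 ∨ (1 : ℝ) = -1 := Or.inl rfl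
  have h2 : (-1 : ℝ) = 1 ∨ (-1 : ℝ) = -1 := Or.inr rfl
  obtain ⟨X₁, X₂, hX₁, hX₂, rfl⟩ := exists_eigen_add_eigen hK (mul_one 1) X
  obtain ⟨Y₁, Y₂, hY₁, hY₂, rfl⟩ := exists_eigen_add_eigen hK (mul_one 1) Y
  obtain ⟨Z₁, Z₂, hZ₁, hZ₂, rfl⟩ := exists_eigen_add_eigen hK (mul_one 1) Z
  have e₁ : ∀ A, θ ![X₁, Y₁, A] = 0 := fun A => by
    obtain ⟨A₁, A₂, hA₁, hA₂, rfl⟩ := exists_eigen_add_eigen hK (mul_one 1) A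
    rw [alt₃_add, h _ _ h1 h1 _ _ _ hX₁ hY₁ hA₁, h _ _ h1 h2 _ _ _ hX₁ hY₁ hA₂, add_zero]
  have e₂ : ∀ A, θ ![X₂, Y₂, A] = 0 := fun A => by
    obtain ⟨A₁, A₂, hA₁, hA₂, rfl⟩ := exists_eigen_add_eigen hK (mul_one 1) A
    rw [alt₃_add, h _ _ h2 h1 _ _ _ hX₂ hY₂ hA₁, h _ _ h2 h2 _ _ _ hX₂ hY₂ hA₂, add_zero]
  -- For mixed first entries, the third entry shares its eigenvalue with one of them; a permutation
  -- brings the equal pair to the front.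
  have e₃ : θ ![X₁, Y₂, Z₁ + Z₂] = 0 := by
    rw [alt₃_add, alt₃_swap' θ X₁ Z₁ Y₂, h _ _ h1 h2 _ _ _ hX₁ hZ₁ hY₂, ← alt₃_cycle θ X₁ Y₂ Z₂,
      h _ _ h2 h1 _ _ _ hY₂ hZ₂ hX₁, neg_zero, add_zero]
  have e₄ : θ ![X₂, Y₁, Z₁ + Z₂] = 0 := by
    rw [alt₃_add, alt₃_swap' θ X₂ Z₂ Y₁, h _ _ h2 h1 _ _ _ hX₂ hZ₂ hY₁, ← alt₃_cycle θ X₂ Y₁ Z₁,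
      h _ _ h1 h2 _ _ _ hY₁ hZ₁ hX₂, neg_zero, add_zero]
  rw [alt₃_add_left, alt₃_add_mid, alt₃_add_mid, e₁, e₂, e₃, e₄]
  norm_num

theorem mlieBracket_add_smul_add_smul [FiniteDimensional ℝ E] {X X' Y Y' : Π x : M, Tan E x}
    (hX : IsSmoothField X) (hX' : IsSmoothField X') (hY : IsSmoothField Y) (hY' : IsSmoothField Y')
    (s : ℝ) (x : M) :
    VectorField.mlieBracket 𝓘(ℝ, E) (X + s • X') (Y + s • Y') x =
      VectorField.mlieBracket 𝓘(ℝ, E) X Y x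
        + s • VectorField.mlieBracket 𝓘(ℝ, E) X' Y x
        + s • VectorField.mlieBracket 𝓘(ℝ, E) X Y' x
        + (s * s) • VectorField.mlieBracket 𝓘(ℝ, E) X' Y' x := by
  have md : ∀ {Z : Π x : M, Tan E x}, IsSmoothField Z → MDifferentiableAt 𝓘(ℝ, E)
      (𝓘(ℝ, E).prod 𝓘(ℝ, E)) (fun x => Bundle.TotalSpace.mk' E x (Z x)) x :=
    fun hZ => ContMDiff.mdifferentiableAt hZ (by simp)
  rw [VectorField.mlieBracket_add_left (md hX) (md (hX'.const_smul s)),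
    VectorField.mlieBracket_add_right (md hY) (md (hY'.const_smul s)),
    VectorField.mlieBracket_add_right (md hY) (md (hY'.const_smul s)),
    VectorField.mlieBracket_const_smul_left (md hX'),
    VectorField.mlieBracket_const_smul_left (md hX'),
    VectorField.mlieBracket_const_smul_right (md hY'),
    VectorField.mlieBracket_const_smul_right (md hY')]
  module

theorem formAction_apply₃ (K : Π x : M, Tan E x →L[ℝ] Tan E x)
    (θ : Π x : M, Tan E x [⋀^Fin 3]→L[ℝ] ℝ) (x : M) (X Y Z : Tan E x) :
    formAction K θ x ![X, Y, Z] = θ x ![K x X, K x Y, K x Z] := by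
  refine congrArg (θ x) ?_
  funext i; fin_cases i <;> rfl

theorem extD_neg {k : ℕ} (θ : Π x : M, Tan E x [⋀^Fin k]→L[ℝ] ℝ) : extD (-θ) = -extD θ := by
  funext x
  ext v
  have h : chartForm (-θ) x = (-1 : ℝ) • chartForm θ x := by
    funext y
    ext w
    exact (neg_one_mul _).symm
  change extD (-θ) x v = -extD θ x v
  rw [extD_apply, extD_apply, h, extDeriv_smul]
  exact neg_one_mul _

/-- Integrability of a para-complex structure in terms of its eigenbundles. -/
theorem isIntegrableParaComplex_iff [FiniteDimensional ℝ E] {K : Π x : M, Tan E x →L[ℝ] Tan E x}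
    (hKK : ∀ x X, K x (K x X) = X)
    (hsm : ∀ X : Π x : M, Tan E x, IsSmoothField X → IsSmoothField fun x => K x (X x)) :
    IsIntegrableParaComplex K ↔ ∀ s : ℝ, (s = 1 ∨ s = -1) → ∀ X Y : Π x : M, Tan E x,
      IsSmoothField X → IsSmoothField Y → (∀ x, K x (X x) = s • X x) →
      (∀ x, K x (Y x) = s • Y x) → ∀ x,
      K x (VectorField.mlieBracket 𝓘(ℝ, E) X Y x) = s • VectorField.mlieBracket 𝓘(ℝ, E) X Y x := by
  constructor
  · intro h s hs X Y hX hY hKX hKY x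
    have h1 := h X Y hX hY x
    have hss : s * s = 1 := by rcases hs with rfl | rfl <;> norm_num
    have md : ∀ {Z : Π x : M, Tan E x}, IsSmoothField Z → MDifferentiableAt 𝓘(ℝ, E)
        (𝓘(ℝ, E).prod 𝓘(ℝ, E)) (fun x => Bundle.TotalSpace.mk' E x (Z x)) x :=
      fun hZ => ContMDiff.mdifferentiableAt hZ (by simp)
    have hKX' : (fun y => K y (X y)) = s • X := funext hKX
    have hKY' : (fun y => K y (Y y)) = s • Y := funext hKY
    unfold nijenhuis at h1
    rw [hKX', hKY', VectorField.mlieBracket_const_smul_left (md hX),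
      VectorField.mlieBracket_const_smul_left (md hX),
      VectorField.mlieBracket_const_smul_right (md hY), smul_smul, hss, map_add, map_smul] at h1
    set w := VectorField.mlieBracket 𝓘(ℝ, E) X Y x
    have h2 : w = s • K x w := by
      -- On s-eigenfields the Nijenhuis tensor is 2([X,Y] - sK[X,Y]).
      have h3 : w - s • K x w = (1 / 2 : ℝ) • (w + (1 : ℝ) • w - (s • K x w + s • K x w)) := by
        module
      rw [h1, smul_zero] at h3
      exact sub_eq_zero.1 h3
    have h4 := congrArg (fun z => s • z) h2
    simp only [smul_smul, hss, one_smul] at h4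
    exact h4.symm
  · intro h X Y hX hY x
    -- X + sKX and Y + sKY are s-eigenfields. Their bracket is A + sB with A = [X,Y] + [KX,KY] and B
    -- = [KX,Y] + [X,KY]; subtracting the eigenvalue equations for s = ±1 gives KB = A, which is N =
    -- 0.
    have key : ∀ s : ℝ, (s = 1 ∨ s = -1) → _ := fun s hs =>
      h s hs (X + s • fun y => K y (X y)) (Y + s • fun y => K y (Y y))
        (hX.add ((hsm X hX).const_smul s)) (hY.add ((hsm Y hY).const_smul s))
        (fun y => by
          have hss : s * s = 1 := by rcases hs with rfl | rfl <;> norm_num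
          simp only [Pi.add_apply, Pi.smul_apply]
          rw [map_add, map_smul, hKK, smul_add, smul_smul, hss, one_smul, add_comm])
        (fun y => by
          have hss : s * s = 1 := by rcases hs with rfl | rfl <;> norm_num
          simp only [Pi.add_apply, Pi.smul_apply]
          rw [map_add, map_smul, hKK, smul_add, smul_smul, hss, one_smul, add_comm]) x
    have h1 := key 1 (Or.inl rfl)
    have h2 := key (-1) (Or.inr rfl)
    rw [mlieBracket_add_smul_add_smul hX (hsm X hX) hY (hsm Y hY)] at h1 h2
    simp only [map_add, map_smul] at h1 h2
    unfold nijenhuis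
    rw [map_add]
    linear_combination (norm := module) (1 / 2 : ℝ) • h2 - (1 / 2 : ℝ) • h1

namespace GenAlmostParaKahler

variable {S : GenAlmostParaKahler E M}

/-- Comparing tangent parts before and after applying 𝒢 determines X + Y and X - Y. -/
theorem lift_add_lift_injective [FiniteDimensional ℝ E] {x : M} {X Y X' Y' : Tan E x}
    (h : S.lift 1 x X + S.lift (-1) x Y = S.lift 1 x X' + S.lift (-1) x Y') :
    X = X' ∧ Y = Y' := by
  have h1 : X + Y = X' + Y' := congrArg Prod.fst h
  have h2 := congrArg (S.G x) h
  rw [(S.G x).map_add, (S.G x).map_add, S.isHalf_plus.G_lift, S.isHalf_plus.G_lift,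
    S.isHalf_minus.G_lift, S.isHalf_minus.G_lift] at h2
  have h3 : (1 : ℝ) • X + (-1 : ℝ) • Y = (1 : ℝ) • X' + (-1 : ℝ) • Y' := congrArg Prod.fst h2
  constructor
  · linear_combination (norm := module) (1 / 2 : ℝ) • h1 + (1 / 2 : ℝ) • h3
  · linear_combination (norm := module) (1 / 2 : ℝ) • h1 - (1 / 2 : ℝ) • h3

theorem isIntegrable_iff_isGood [FiniteDimensional ℝ E] [T2Space M]
    {H : Π x : M, Tan E x [⋀^Fin 3]→L[ℝ] ℝ} :
    S.IsIntegrable H ↔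
      (∀ s : ℝ, (s = 1 ∨ s = -1) → S.IsGood H 1 S.tanKPlus S.omegaPlus s) ∧
        ∀ s : ℝ, (s = 1 ∨ s = -1) → S.IsGood H (-1) S.tanKMinus S.omegaMinus s := by
  refine ⟨fun h => ⟨fun s hs => S.isHalf_plus.isGood_of_isIntegrable h hs,
    fun s hs => S.isHalf_minus.isGood_of_isIntegrable h hs⟩, fun ⟨hp, hm⟩ => ?_⟩
  have invP : ∀ a : ℝ, (a = 1 ∨ a = -1) → IsInvolutive H (eigenbundle S.KPlus a) := by
    intro a ha
    have haa : a * a = 1 := by rcases ha with rfl | rfl <;> norm_num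
    refine isInvolutive_of_isGood S.isHalf_plus S.isHalf_minus haa haa (hp a ha) (hm a ha)
      S.paraComplex.sq S.paraComplex.anti haa fun x X Y hXY => ?_
    rw [mem_eigenbundle, (S.KPlus x).map_add, ← S.isHalf_plus.lift_K, ← S.isHalf_minus.lift_K,
      smul_add, ← map_smul, ← map_smul] at hXY
    exact lift_add_lift_injective hXY
  have invM : ∀ a : ℝ, (a = 1 ∨ a = -1) → IsInvolutive H (eigenbundle S.KMinus a) := by
    intro a ha
    have haa : a * a = 1 := by rcases ha with rfl | rfl <;> norm_num
    have ha' : -a = 1 ∨ -a = -1 := by rcases ha with rfl | rfl <;> simp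
    refine isInvolutive_of_isGood S.isHalf_plus S.isHalf_minus haa ((neg_mul_neg a a).trans haa)
      (hp a ha) (hm (-a) ha') S.KMinus_KMinus S.pairing_KMinus haa fun x X Y hXY => ?_
    rw [mem_eigenbundle, (S.KMinus x).map_add, KMinus_apply, KMinus_apply,
      ← S.isHalf_plus.lift_K, ← S.isHalf_minus.lift_K, S.isHalf_plus.G_lift, S.isHalf_minus.G_lift,
      smul_add, ← (S.lift 1 x).map_smul, ← (S.lift (-1) x).map_smul, ← (S.lift 1 x).map_smul,
      ← (S.lift (-1) x).map_smul] at hXY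
    obtain ⟨h1, h2⟩ := lift_add_lift_injective hXY
    rw [one_smul] at h1
    refine ⟨h1, ?_⟩
    linear_combination (norm := module) (-1 : ℝ) • h2
  exact ⟨⟨invP 1 (Or.inl rfl), invP (-1) (Or.inr rfl)⟩, invM 1 (Or.inl rfl), invM (-1) (Or.inr rfl)⟩

/-! ### The fundamental form of an integrable half -/

namespace IsHalf

variable [FiniteDimensional ℝ E] [T2Space M] {H : Π x : M, Tan E x [⋀^Fin 3]→L[ℝ] ℝ} {e : ℝ}
  {K : Π x : M, Tan E x →L[ℝ] Tan E x} {Ω : Π x : M, Tan E x [⋀^Fin 2]→L[ℝ] ℝ}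

/-- The eigenbundle is isotropic for ω and closed under brackets, so every term of the invariant
formula for dω vanishes. -/
theorem extD_omega_eq_zero (h : S.IsHalf e K Ω) (hint : IsIntegrableParaComplex K) {s : ℝ}
    (hs : s = 1 ∨ s = -1) {x : M} {X Y Z : Tan E x} (hX : K x X = s • X) (hY : K x Y = s • Y)
    (hZ : K x Z = s • Z) : extD Ω x ![X, Y, Z] = 0 := by
  have hss : s * s = 1 := by rcases hs with rfl | rfl <;> norm_num
  have hinv := (isIntegrableParaComplex_iff h.K_K fun _ => h.isSmoothField_K).1 hint s hs
  obtain ⟨X', hX', hKX, rfl⟩ := h.exists_field hss hX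
  obtain ⟨Y', hY', hKY, rfl⟩ := h.exists_field hss hY
  obtain ⟨Z', hZ', hKZ, rfl⟩ := h.exists_field hss hZ
  have hzero : ∀ {x : M} {A B : Tan E x}, K x A = s • A → K x B = s • B → Ω x ![A, B] = 0 :=
    fun hA hB => by
      rw [h.omega_apply, hA, map_smul, _root_.smul_apply, h.eta_eq_zero hss hA hB, smul_zero]
  have hd : differential (E := E) (fun _ : M => (0 : ℝ)) x = 0 := mfderiv_const
  rw [extD_twoForm_apply_fields h.isSmoothOnFields_omega hX' hY' hZ']
  simp only [hzero (hKX _) (hKY _), hzero (hKX _) (hKZ _), hzero (hKY _) (hKZ _),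
    hzero (hinv _ _ hX' hY' hKX hKY x) (hKZ x), hzero (hinv _ _ hX' hZ' hKX hKZ x) (hKY x),
    hzero (hinv _ _ hY' hZ' hKY hKZ x) (hKX x), hd, _root_.zero_apply]
  norm_num

/-- Testing on eigenvectors of type (s,s,t) suffices, and there Λ³K acts by s·s·t = t. For t = -s
the two conditions agree up to the factor -e; for t = s the term in dω is zero in both. -/
theorem isGood_iff (h : S.IsHalf e K Ω) :
    (∀ s : ℝ, (s = 1 ∨ s = -1) → S.IsGood H e K Ω s) ↔
      IsIntegrableParaComplex K ∧ ∀ x X Y Z,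
        extD Ω x ![K x X, K x Y, K x Z] = e * (H x ![X, Y, Z] + extD S.b x ![X, Y, Z]) := by
  have hinv := isIntegrableParaComplex_iff h.K_K fun _ => h.isSmoothField_K
  have hee := h.mul_self
  have hsmul : ∀ (x : M) (s t : ℝ) (X Y Z : Tan E x), s * s = 1 →
      extD Ω x ![s • X, s • Y, t • Z] = t * extD Ω x ![X, Y, Z] := fun x s t X Y Z hs => by
    rw [alt₃_smul, ← alt₃_cycle, alt₃_smul, ← alt₃_cycle, alt₃_smul, alt₃_cycle _ Y Z X,
      alt₃_cycle _ X Y Z]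
    linear_combination t * extD Ω x ![X, Y, Z] * hs
  constructor
  · intro hg
    have hint : IsIntegrableParaComplex K := hinv.2 fun s hs X Y hX hY hKX hKY x =>
      (hg s hs X Y hX hY hKX hKY x).1
    refine ⟨hint, fun x X Y Z => ?_⟩
    have h0 := alt₃_eq_zero_of_eigen (h.K_K x)
      (formAction K (extD Ω) x - e • (H x + extD S.b x)) (fun s t hs ht X Y Z hX hY hZ => ?_) X Y Z
    · change formAction K (extD Ω) x ![X, Y, Z] -
        e * (H x ![X, Y, Z] + extD S.b x ![X, Y, Z]) = 0 at h0
      rw [formAction_apply₃] at h0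
      linarith
    · change formAction K (extD Ω) x ![X, Y, Z] -
        e * (H x ![X, Y, Z] + extD S.b x ![X, Y, Z]) = 0
      have hss : s * s = 1 := by rcases hs with rfl | rfl <;> norm_num
      rw [formAction_apply₃, hX, hY, hZ, hsmul _ _ _ _ _ _ hss]
      -- Replaces t dω by -s dω in both cases: either dω vanishes on the triple or t = -s.
      have hst : (s + t) * extD Ω x ![X, Y, Z] = 0 := by
        by_cases hst : t = s
        · rw [h.extD_omega_eq_zero hint hs hX hY (hst ▸ hZ), mul_zero]
        · have : s + t = 0 := by
            rcases hs with rfl | rfl <;> rcases ht with rfl | rfl <;> simp_all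
          rw [this, zero_mul]
      obtain ⟨X', hX', hKX, rfl⟩ := h.exists_field hss hX
      obtain ⟨Y', hY', hKY, rfl⟩ := h.exists_field hss hY
      have h1 := (hg s hs X' Y' hX' hY' hKX hKY x).2 Z
      linear_combination hst - e * h1 + s * extD Ω x ![X' x, Y' x, Z] * hee
  · rintro ⟨hint, hform⟩ s hs X Y hX hY hKX hKY x
    refine ⟨hinv.1 hint s hs X Y hX hY hKX hKY x, fun z => ?_⟩
    have hss : s * s = 1 := by rcases hs with rfl | rfl <;> norm_num
    obtain ⟨z₁, z₂, hz₁, hz₂, rfl⟩ := exists_eigen_add_eigen (h.K_K x) hss z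
    have h1 := hform x (X x) (Y x) z₁
    have h2 := hform x (X x) (Y x) z₂
    rw [hKX, hKY, hz₁, hsmul _ _ _ _ _ _ hss,
      h.extD_omega_eq_zero hint hs (hKX x) (hKY x) hz₁] at h1
    rw [hKX, hKY, hz₂, hsmul _ _ _ _ _ _ hss] at h2
    rw [alt₃_add, alt₃_add, alt₃_add, h.extD_omega_eq_zero hint hs (hKX x) (hKY x) hz₁]
    linear_combination -e * h1 - e * h2 - (H x ![X x, Y x, z₁] + extD S.b x ![X x, Y x, z₁] +
      H x ![X x, Y x, z₂] + extD S.b x ![X x, Y x, z₂]) * hee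

/-- K is anti-orthogonal for η, hence (Λ²K)ω = -ω, which is the only source of the sign. -/
theorem dP_omega_apply (h : S.IsHalf e K Ω) (x : M) (X Y Z : Tan E x) :
    dP K Ω x ![X, Y, Z] = -extD Ω x ![K x X, K x Y, K x Z] := by
  have h1 : formAction K Ω = -Ω := by
    funext y
    ext v
    have hv : v = ![v 0, v 1] := by funext i; fin_cases i <;> rfl
    have h2 : (fun i => K y (v i)) = ![K y (v 0), K y (v 1)] := by
      funext i; fin_cases i <;> rfl
    change Ω y (fun i => K y (v i)) = -Ω y v
    rw [h2, hv, h.omega_apply, h.omega_apply, h.eta_K_K]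
    rfl
  unfold dP
  rw [h1, formAction_apply₃, extD_neg]
  rfl

end IsHalf

end GenAlmostParaKahler

end

end GenGeom

end

theorem mainTheorem1 {E : Type*} [NormedAddCommGroup E] [NormedSpace ℝ E] [FiniteDimensional ℝ E]
    {M : Type*} [TopologicalSpace M] [T2Space M] [SecondCountableTopology M]
    [ChartedSpace E M] [IsManifold 𝓘(ℝ, E) ∞ M]
    (H : Π x : M, GenGeom.Tan E x [⋀^Fin 3]→L[ℝ] ℝ)
    (hH : GenGeom.IsSmoothForm H) (hHclosed : GenGeom.extD H = 0)
    (S : GenGeom.GenAlmostParaKahler E M) :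
    S.IsIntegrable H ↔
      (GenGeom.IsIntegrableParaComplex S.tanKPlus ∧ GenGeom.IsIntegrableParaComplex S.tanKMinus) ∧
        (GenGeom.dP S.tanKPlus S.omegaPlus = -GenGeom.dP S.tanKMinus S.omegaMinus ∧
          -GenGeom.dP S.tanKMinus S.omegaMinus = -(H + GenGeom.extD S.b)) := by
  rw [GenGeom.GenAlmostParaKahler.isIntegrable_iff_isGood, S.isHalf_plus.isGood_iff,
    S.isHalf_minus.isGood_iff, and_and_and_comm]
  refine and_congr_right fun _ => ?_
  have hext : ∀ θ θ' : Π x : M, GenGeom.Tan E x [⋀^Fin 3]→L[ℝ] ℝ,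
      θ = θ' ↔ ∀ x X Y Z, θ x ![X, Y, Z] = θ' x ![X, Y, Z] := fun θ θ' => by
    refine ⟨fun h _ _ _ _ => by rw [h], fun h => funext fun x => ?_⟩
    ext v
    have hv : v = ![v 0, v 1, v 2] := by funext i; fin_cases i <;> rfl
    rw [hv]
    exact h x _ _ _
  have hp := S.isHalf_plus.dP_omega_apply
  have hm := S.isHalf_minus.dP_omega_apply
  have hneg : ∀ (x : M) (X Y Z : GenGeom.Tan E x),
      (-GenGeom.dP S.tanKMinus S.omegaMinus) x ![X, Y, Z] =
        -GenGeom.dP S.tanKMinus S.omegaMinus x ![X, Y, Z] := fun _ _ _ _ => rfl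
  have hadd : ∀ (x : M) (X Y Z : GenGeom.Tan E x),
      (-(H + GenGeom.extD S.b)) x ![X, Y, Z] =
        -(H x ![X, Y, Z] + GenGeom.extD S.b x ![X, Y, Z]) := fun _ _ _ _ => rfl
  -- Both sides are now linear relations between (Λ³K_±)dω_± and H + db at each triple of vectors.
  simp only [hext, hneg, hadd, hp, hm]
  constructor
  · rintro ⟨h1, h2⟩
    refine ⟨fun x X Y Z => ?_, fun x X Y Z => ?_⟩
    · linarith [h1 x X Y Z, h2 x X Y Z]
    · linarith [h2 x X Y Z]
  · rintro ⟨h1, h2⟩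
    refine ⟨fun x X Y Z => ?_, fun x X Y Z => ?_⟩
    · linarith [h1 x X Y Z, h2 x X Y Z]
    · linarith [h2 x X Y Z]
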